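/- Let $\beta>0$ and let $K$ be the Klein bottle $\mathbb{R}^2/\langle\sigma,t\rangle$, where $\mathbb{R}^2=\mathbb{C}$, $\sigma(z)=\bar z+\pi$ and $t(z)=z+2i\beta$; let $g_\beta$ be the flat metric induced on $K$ by the Euclidean metric. For a (continuous) Riemannian metric $g$ on $K$, let $\mathrm{vol}(g)$ be its area, let $l_\sigma(g)$ be the least length of a closed curve in the free homotopy class of a primitive glide reflection (that is, the class of $\sigma$ or of $t\sigma$: the cores of the two Möbius bands of $K$, which are exchanged by the translation $z\mapsto z+i\beta$), let $l_v(g)$ be the least length of a closed curve in the free homotopy class of the vertical translation $t$, and let $l_h(g)$ be the least length of a closed curve in the free homotopy class of the horizontal translation $\sigma^2$ (least lengths being infima over rectifiable curves). There is exactly one $\omega\in\left]0,\frac{\pi}{2}\right[$ with $$\beta=2\ln\left(\tan\left(\frac{\pi}{4}+\frac{\omega}{2}\right)\right)+\frac{2}{\cos\omega}\left(\tan\omega-\omega+\sqrt{\tan^2\omega-\omega\tan\omega+\omega^2}\right).$$ For this $\omega$, put $b=\tan\omega+\sqrt{\tan^2\omega-\omega\tan\omega+\omega^2}$ (so $b>\omega$).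 Then every Riemannian metric $g$ on $K$ that is conformal to $g_\beta$ satisfies $$l_\sigma(g)\,l_v(g)\,l_h(g)\le\frac{\sqrt{\pi}}{3\sqrt{3}}\cdot\frac{\left(b^4-4b\omega+\omega^2+\omega^4-2b^2(-2+\omega^2)\right)^{1/4}(2b-\omega)}{(b-\omega)\sqrt{(b-\omega)b}}\;\mathrm{vol}(g)^{3/2}.$$ Moreover, equality is attained by the flat-spherical metric $E_b=f(v)^2du^2+dv^2$ ($|u|\le\frac{\pi}{2}$, $|v|\le 2b$), where $f$ is the continuous, even, $2b$-periodic function with $f(v)=\cos v$ for $|v|\le\omega$ and $f(v)=\cos\omega$ for $\omega\le|v|\le b$; this metric is conformal to $g_\beta$ through the coordinates $x=u$, $y=\int_0^v\frac{ds}{f(s)}$. -/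

import Mathlib

open Real

noncomputable section

namespace Klein

/-- The glide reflection `z ↦ z̄ + π` of the plane. -/
def glide : Equiv.Perm ℂ where
  toFun z := (starRingEnd ℂ) z + (π : ℂ)
  invFun z := (starRingEnd ℂ) z - (π : ℂ)
  left_inv z := by simp
  right_inv z := by simp

/-- The vertical translation `z ↦ z + 2 i β` of the plane. -/
def vert (β : ℝ) : Equiv.Perm ℂ := Equiv.addRight (2 * Complex.I * (β : ℂ))

/-- The group of transformations of the plane generated by the glide reflection and the vertical
translation. -/
def deckGroup (β : ℝ) : Subgroup (Equiv.Perm ℂ) := Subgroup.closure {glide, vert β}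

/-- The glide reflection `σ` as an element of the group. -/
def σ (β : ℝ) : deckGroup β := ⟨glide, Subgroup.subset_closure (by simp)⟩

/-- The vertical translation `t` as an element of the group. -/
def t (β : ℝ) : deckGroup β := ⟨vert β, Subgroup.subset_closure (by simp)⟩

/-- The Klein bottle `K`: the quotient (with the quotient topology) of the plane by the group
generated by `σ` and `t`. -/
abbrev KleinBottle (β : ℝ) : Type := MulAction.orbitRel.Quotient (deckGroup β) ℂ

/-- The projection of the plane onto the Klein bottle. -/
def proj (β : ℝ) (z : ℂ) : KleinBottle β := Quotient.mk (MulAction.orbitRel (deckGroup β) ℂ) z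

theorem continuous_proj (β : ℝ) : Continuous (proj β) := continuous_quotient_mk'

theorem proj_smul (β : ℝ) (τ : deckGroup β) (z : ℂ) : proj β (τ • z) = proj β z :=
  Quotient.sound (s := MulAction.orbitRel (deckGroup β) ℂ)
    (MulAction.orbitRel_apply.2 (MulAction.mem_orbit z τ))

/-- A (continuous) Riemannian metric on the Klein bottle, that is, a Riemannian metric on its
universal cover, the plane, that is invariant under the pullback by the generators `σ`, `t` of the
deck group (their differentials are `v ↦ v̄` and the identity).  Only continuity of the metric is
required, so all smooth metrics are included, as well as the metrics that are smooth only
piecewise. -/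
structure RiemannianMetric (β : ℝ) where
  /-- The scalar product on the tangent space at a point. -/
  inner : ℂ → ℂ →L[ℝ] ℂ →L[ℝ] ℝ
  symm : ∀ z v w, inner z v w = inner z w v
  pos : ∀ z v, v ≠ 0 → 0 < inner z v v
  continuous : Continuous inner
  glide_invariant : ∀ z v w,
    inner (glide z) ((starRingEnd ℂ) v) ((starRingEnd ℂ) w) = inner z v w
  vert_invariant : ∀ z v w, inner (vert β z) v w = inner z v w

/-- The flat metric `g_β` induced by the Euclidean metric of the plane. -/
def flatMetric (β : ℝ) : RiemannianMetric β where
  inner _ := innerSL ℝ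
  symm _ v w := real_inner_comm w v
  pos _ _ hv := real_inner_self_pos.2 hv
  continuous := continuous_const
  glide_invariant _ v w := LinearIsometryEquiv.inner_map_map Complex.conjLIE v w
  vert_invariant _ _ _ := rfl

/-- `g` is conformal to `g'`: it is the product of `g'` and a positive function. -/
def IsConformalTo {β : ℝ} (g g' : RiemannianMetric β) : Prop :=
  ∃ c : ℂ → ℝ, (∀ z, 0 < c z) ∧ ∀ z v w, g.inner z v w = c z * g'.inner z v w

/-- The volume (area) of the Klein bottle: the integral of the area density over the fundamental
domain `|x| ≤ π / 2`, `|y| ≤ β`. -/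
def vol {β : ℝ} (g : RiemannianMetric β) : ℝ :=
  ∫ z in (Set.Icc (-(π / 2)) (π / 2)) ×ℂ (Set.Icc (-β) β),
    √(g.inner z 1 1 * g.inner z Complex.I Complex.I - g.inner z 1 Complex.I ^ 2)

/-- The closed curve of the Klein bottle that is covered by the segment from `0` to `τ 0`; it
represents the free homotopy class of the element `τ` of the fundamental group. -/
def deckLoop (β : ℝ) (τ : deckGroup β) : C(UnitAddCircle, KleinBottle β) where
  toFun := AddCircle.liftIco 1 0 fun s : ℝ => proj β ((s : ℂ) * (τ • (0 : ℂ)))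
  continuous_toFun := by
    refine AddCircle.liftIco_zero_continuous ?_ ?_
    · simp [proj_smul]
    · exact ((continuous_proj β).comp (by fun_prop)).continuousOn

/-- `c` is a rectifiable (that is, Lipschitz) parametrization, lifted to the plane, of the closed
curve `γ` of the Klein bottle. -/
def IsRectifiableLift {β : ℝ} (γ : C(UnitAddCircle, KleinBottle β)) (c : ℝ → ℂ) : Prop :=
  (∃ C, LipschitzOnWith C c (Set.Icc 0 1)) ∧
    ∀ s ∈ Set.Icc (0 : ℝ) 1, proj β (c s) = γ (s : UnitAddCircle)

/-- The length of the image in the Klein bottle of the path `c : [0, 1] → ℂ`. -/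
def length {β : ℝ} (g : RiemannianMetric β) (c : ℝ → ℂ) : ℝ :=
  ∫ s in (0 : ℝ)..1, √(g.inner (c s) (deriv c s) (deriv c s))

/-- The least length of a rectifiable closed curve whose free homotopy class is one of those of
the elements of `T`. -/
def leastLength {β : ℝ} (g : RiemannianMetric β) (T : Set (deckGroup β)) : ℝ :=
  sInf {L | ∃ γ : C(UnitAddCircle, KleinBottle β), ∃ c : ℝ → ℂ,
    (∃ τ ∈ T, γ.Homotopic (deckLoop β τ)) ∧ IsRectifiableLift γ c ∧ L = length g c}

/-- `l_σ`: the least length of a closed curve homotopic to one closed by a glide reflection `σ` or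
`t σ`.  Modulo conjugation and inversion these are the two primitive glide reflections of the
group; the translation by `i β`, a symmetry of the flat Klein bottle, exchanges their classes,
which are those of the cores of the two Möbius bands that the bottle is made of. -/
def lSigma {β : ℝ} (g : RiemannianMetric β) : ℝ := leastLength g {σ β, t β * σ β}

/-- `l_v`: the least length of a closed curve in the class of the vertical translation `t`. -/
def lVert {β : ℝ} (g : RiemannianMetric β) : ℝ := leastLength g {t β}

/-- `l_h`: the least length of a closed curve in the class of the horizontal translation `σ²`. -/
def lHor {β : ℝ} (g : RiemannianMetric β) : ℝ := leastLength g {σ β ^ 2}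

/-- The even `2 b`-periodic function equal to `cos v` for `|v| ≤ ω` and to `cos ω` for
`ω ≤ |v| ≤ b`; here `|v - 2 b round (v / (2 b))|` is the distance of `v` to `2 b ℤ`. -/
def profile (ω b v : ℝ) : ℝ := cos (min |v - 2 * b * round (v / (2 * b))| ω)

/-- `g` is the flat-spherical metric `E_b`, that is, the metric `f(v)² du² + dv²` with
`f = profile ω b` (spherical where `v` is at distance at most `ω` from `2 b ℤ`, flat elsewhere),
written in the coordinates `x = u`, `y = ∫₀ᵛ ds / f(s)`: the differential of
`(u, v) ↦ x + i y` sends `(p, q)` to `p + i q / f(v)`. -/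
def IsFlatSpherical {β : ℝ} (ω b : ℝ) (g : RiemannianMetric β) : Prop :=
  ∀ u v p q p' q' : ℝ,
    g.inner ⟨u, ∫ s in (0 : ℝ)..v, 1 / profile ω b s⟩ ⟨p, q / profile ω b v⟩
      ⟨p', q' / profile ω b v⟩ = profile ω b v ^ 2 * (p * p') + q * q'

end Klein

end

open Real

/-! The proof is a length-area argument. Write $g=q^2g_\beta$, let $m(y)$ be the integral of $q$
over a horizontal segment of length $2\pi$ at height $y$, and put $\Psi(y)=m(y)+m(y+\beta)$.
Averaging over horizontal translations the lengths of suitable curves in each class gives lower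
bounds for integrals of $\Psi$: horizontal circles for $l_h$, vertical segments for $l_v$, and, for
$l_\sigma$, half great circles of the unit sphere drawn in Mercator coordinates and centred on the
axes $y=0$ and $y=\beta$. Indeed a half great circle joins antipodal points, so it is closed by a
glide reflection.

The extremal conformal factor is proportional to $D(y)$, equal to $1/\cosh y$ on the spherical zone
$0\le y\le Y$, where $\tanh Y=\sin\omega$, and to $k=\cos\omega$ on the flat zone $Y\le
y\le\beta/2$. The three families are mixed so that their total density is exactly $D$. Vertical
curves contribute a constant $A=ak$, horizontal curves contribute $k-A$ on the flat zone, and great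
circles must contribute $1/\cosh y-A$ on the spherical zone. The last requirement is an Abel
integral equation: with $p=\tanh y$, the circles of radius $r<R=\sin\omega$ in the $(p,q)$-plane
represent great circles, and the radial weight `abelWeight` solves it (`lintegral_abelWeight`,
`zone_inequality`). Cauchy–Schwarz for $\int\Psi D$ then bounds a weighted sum of the three lengths
by the square root of the area (`IsConformalFactor.weighted_inequality`), and the inequality of
arithmetic and geometric means yields the product (`sq_mul_le_of_weighted`). The values of $a$ and
$b$ are those for which the three weighted terms coincide for $E_b$.

For sharpness, the area of $E_b$ is computed and its three least lengths are bounded below by $\pi$,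
$4b$ and $2\pi\cos\omega$. Each bound comes from a function that varies no faster than arc length
and whose change along the curve is known (`IsConformalFactor.abs_sub_le_length`): longitude,
latitude, and a regularized spherical distance to the starting point. The endpoints of a lifted
curve are controlled by covering theory (`exists_conjugate_of_homotopic`). -/

namespace Klein

/-! ### Mixing circles in a disc: the Abel integral equation. -/

section Abel

open MeasureTheory Set

/-- The density, as a function of the squared radius, of the mixture of circles of radius less
than `R` that is used to fill the spherical zone with great circles. -/
noncomputable def abelWeight (R a x : ℝ) : ℝ :=
  (1 - a) / √(R ^ 2 - x) + a * √(R ^ 2 - x) / (1 - x)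

theorem measurable_abelWeight (R a : ℝ) : Measurable (abelWeight R a) := by
  unfold abelWeight
  fun_prop

theorem abelWeight_nonneg {R a x : ℝ} (ha0 : 0 ≤ a) (ha1 : a ≤ 1) (hx : x ≤ 1) :
    0 ≤ abelWeight R a x := by
  unfold abelWeight
  have : 0 ≤ 1 - a := by linarith
  have : 0 ≤ 1 - x := by linarith
  positivity

theorem hasDerivAt_arcsin_div {Q q : ℝ} (hq : q ∈ Ioo (-Q) Q) :
    HasDerivAt (fun q => arcsin (q / Q)) (1 / √(Q ^ 2 - q ^ 2)) q := by
  have hQ : 0 < Q := by linarith [hq.1, hq.2]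
  have h1 : -1 < q / Q := by rw [lt_div_iff₀ hQ]; linarith [hq.1]
  have h2 : q / Q < 1 := by rw [div_lt_iff₀ hQ]; linarith [hq.2]
  have h := (hasDerivAt_arcsin h1.ne' h2.ne).comp q ((hasDerivAt_id q).div_const Q)
  convert! h using 1
  have : Q ^ 2 - q ^ 2 = Q ^ 2 * (1 - (q / Q) ^ 2) := by field_simp
  rw [this, sqrt_mul (sq_nonneg Q), sqrt_sq hQ.le]
  simp [mul_comm]

/-- Needed because $\sqrt{Q^2-q^2}/D=1/\sqrt{Q^2-q^2}-k^2/(D\sqrt{Q^2-q^2})$ with $D=k^2+Q^2-q^2$: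
this arcsine integrates the last term, up to a constant factor. -/
theorem hasDerivAt_arcsin_quotient {Q k q : ℝ} (hk : 0 < k) (hq : q ∈ Ioo (-Q) Q) :
    HasDerivAt (fun q => arcsin (k * q / (Q * √(k ^ 2 + Q ^ 2 - q ^ 2))))
      (k * √(k ^ 2 + Q ^ 2) / ((k ^ 2 + Q ^ 2 - q ^ 2) * √(Q ^ 2 - q ^ 2))) q := by
  have hQ : 0 < Q := by linarith [hq.1, hq.2]
  have hqQ : 0 < Q ^ 2 - q ^ 2 := by nlinarith [hq.1, hq.2]
  have hD : 0 < k ^ 2 + Q ^ 2 - q ^ 2 := by nlinarith [sq_pos_of_pos hk]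
  have hB : 0 < k ^ 2 + Q ^ 2 := by positivity
  set S := √(k ^ 2 + Q ^ 2 - q ^ 2) with hS
  have hS0 : 0 < S := sqrt_pos.2 hD
  have hS2 : S ^ 2 = k ^ 2 + Q ^ 2 - q ^ 2 := sq_sqrt hD.le
  set B := √(k ^ 2 + Q ^ 2)
  have hB0 : 0 < B := sqrt_pos.2 hB
  have hB2 : B ^ 2 = k ^ 2 + Q ^ 2 := sq_sqrt hB.le
  set E := √(Q ^ 2 - q ^ 2)
  have hE0 : 0 < E := sqrt_pos.2 hqQ
  have hE2 : E ^ 2 = Q ^ 2 - q ^ 2 := sq_sqrt hqQ.le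
  have hone : 1 - (k * q / (Q * S)) ^ 2 = (B * E / (Q * S)) ^ 2 := by
    field_simp
    rw [hS2, hB2, hE2]
    ring
  have hlt : (k * q / (Q * S)) ^ 2 < 1 := by
    have : 0 < (B * E / (Q * S)) ^ 2 := by positivity
    linarith
  have habs := abs_lt.1 ((sq_lt_one_iff_abs_lt_one _).1 hlt)
  have hroot : HasDerivAt (fun q : ℝ => √(k ^ 2 + Q ^ 2 - q ^ 2)) (-q / S) q := by
    have h := (((hasDerivAt_id q).pow 2).const_sub (k ^ 2 + Q ^ 2)).sqrt hD.ne'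
    convert! h using 1
    change -q / S = -(((2 : ℕ) : ℝ) * q ^ (2 - 1) * 1) / (2 * S)
    field_simp
    push_cast
    ring
  have hquot : HasDerivAt (fun q : ℝ => k * q / (Q * √(k ^ 2 + Q ^ 2 - q ^ 2)))
      (k * B ^ 2 / (Q * S ^ 3)) q := by
    have h := ((hasDerivAt_id q).const_mul k).div (hroot.const_mul Q) (by positivity)
    convert! h using 1
    simp only [id, ← hS]
    field_simp
    rw [hB2]
    linear_combination (-1 : ℝ) * hS2
  have h := (hasDerivAt_arcsin habs.1.ne' habs.2.ne).comp q hquot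
  convert! h using 1
  rw [hone, sqrt_sq (by positivity), ← hS2]
  field_simp

/-- The chords of the discs fill the zone with a density that leaves room for the meridians. -/
theorem lintegral_abelWeight {R a p : ℝ} (hR0 : 0 < R) (hR1 : R < 1) (ha0 : 0 ≤ a) (ha1 : a ≤ 1)
    (hp : p ∈ Ioo (-R) R) :
    ∫⁻ q in Ioo (-√(R ^ 2 - p ^ 2)) √(R ^ 2 - p ^ 2),
      ENNReal.ofReal (abelWeight R a (p ^ 2 + q ^ 2)) =
    ENNReal.ofReal (π * (1 - a * √(1 - R ^ 2) / √(1 - p ^ 2))) := by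
  have hpR : 0 < R ^ 2 - p ^ 2 := by nlinarith [hp.1, hp.2]
  have hk2 : 0 < 1 - R ^ 2 := by nlinarith
  set k := √(1 - R ^ 2)
  have hk : 0 < k := sqrt_pos.2 hk2
  have hksq : k ^ 2 = 1 - R ^ 2 := sq_sqrt hk2.le
  set Q := √(R ^ 2 - p ^ 2)
  have hQ : 0 < Q := sqrt_pos.2 hpR
  have hQsq : Q ^ 2 = R ^ 2 - p ^ 2 := sq_sqrt hpR.le
  have hkQ : k ^ 2 + Q ^ 2 = 1 - p ^ 2 := by linarith
  set F : ℝ → ℝ := fun q => arcsin (q / Q) -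
    a * k / √(1 - p ^ 2) * arcsin (k * q / (Q * √(k ^ 2 + Q ^ 2 - q ^ 2))) with hF
  have hcont : ContinuousOn F (Icc (-Q) Q) := by
    refine ContinuousOn.sub (by fun_prop) (ContinuousOn.mul continuousOn_const ?_)
    refine continuous_arcsin.comp_continuousOn (ContinuousOn.div (by fun_prop) (by fun_prop) ?_)
    intro q hq
    have : 0 < k ^ 2 + Q ^ 2 - q ^ 2 := by nlinarith [hq.1, hq.2, sq_pos_of_pos hk]
    positivity
  have hderiv : ∀ q ∈ Ioo (-Q) Q, HasDerivAt F (abelWeight R a (p ^ 2 + q ^ 2)) q := by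
    intro q hq
    have hqQ : 0 < Q ^ 2 - q ^ 2 := by nlinarith [hq.1, hq.2]
    have hD : 0 < k ^ 2 + Q ^ 2 - q ^ 2 := by nlinarith [sq_pos_of_pos hk]
    have h := (hasDerivAt_arcsin_div hq).sub
      ((hasDerivAt_arcsin_quotient hk hq).const_mul (a * k / √(1 - p ^ 2)))
    convert! h using 1
    rw [abelWeight, show R ^ 2 - (p ^ 2 + q ^ 2) = Q ^ 2 - q ^ 2 by linarith,
      show 1 - (p ^ 2 + q ^ 2) = k ^ 2 + Q ^ 2 - q ^ 2 by linarith, hkQ]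
    have hB0 : 0 < √(1 - p ^ 2) := sqrt_pos.2 (by nlinarith)
    rw [← hkQ]
    have hE0 : 0 < √(Q ^ 2 - q ^ 2) := sqrt_pos.2 hqQ
    have hE2 : √(Q ^ 2 - q ^ 2) ^ 2 = Q ^ 2 - q ^ 2 := sq_sqrt hqQ.le
    rw [← hkQ] at hB0
    field_simp
    rw [hE2]
    ring
  have hnonneg : ∀ q ∈ Ioo (-Q) Q, 0 ≤ abelWeight R a (p ^ 2 + q ^ 2) := by
    intro q hq
    refine abelWeight_nonneg ha0 ha1 ?_
    nlinarith [hq.1, hq.2]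
  have hle : -Q ≤ Q := by linarith
  -- For $a<1$ the weight blows up at $\pm Q$; it is integrable as the nonnegative derivative of a
  -- function continuous up to the ends.
  have hint : IntervalIntegrable (fun q => abelWeight R a (p ^ 2 + q ^ 2)) volume (-Q) Q := by
    refine intervalIntegral.intervalIntegrable_deriv_of_nonneg (g := F) ?_ ?_ ?_
    · rwa [uIcc_of_le hle]
    · simpa [min_eq_left hle, max_eq_right hle] using hderiv
    · simpa [min_eq_left hle, max_eq_right hle] using hnonneg
  have hval := intervalIntegral.integral_eq_sub_of_hasDerivAt_of_le hle hcont hderiv hint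
  -- At $q=\pm Q$ both arcsines have argument $\pm1$, so each increases by $\pi$.
  have hend : F Q - F (-Q) = π * (1 - a * k / √(1 - p ^ 2)) := by
    have e : k ^ 2 + Q ^ 2 - Q ^ 2 = k ^ 2 := by ring
    have e1 : k * Q / (Q * k) = 1 := by field_simp
    simp only [hF, neg_sq, e, sqrt_sq hk.le, neg_div, mul_neg, e1, div_self hQ.ne', arcsin_neg,
      arcsin_one]
    ring
  rw [← hend, ← hval, intervalIntegral.integral_of_le hle, integral_Ioc_eq_integral_Ioo,
    ofReal_integral_eq_lintegral_ofReal]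
  · exact ((intervalIntegrable_iff_integrableOn_Ioo_of_le hle).1 hint)
  · exact (ae_restrict_iff' measurableSet_Ioo).2 (.of_forall hnonneg)

/-- Integration over a disc in polar and in cartesian coordinates, of the product of a radial
weight and a function of the first coordinate. -/
theorem lintegral_disc {R : ℝ} {w : ℝ → ℝ} (hw : Measurable w) {G : ℝ → ENNReal}
    (hG : Measurable G) :
    ∫⁻ r in Ioo 0 R, ENNReal.ofReal (r * w (r ^ 2)) * ∫⁻ s in Ioo (-π) π, G (r * cos s) =
    ∫⁻ p in Ioo (-R) R, G p *
      ∫⁻ q in Ioo (-√(R ^ 2 - p ^ 2)) √(R ^ 2 - p ^ 2), ENNReal.ofReal (w (p ^ 2 + q ^ 2)) := by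
  -- The condition on the first coordinate matters only for $R<0$, where it empties the disc, so
  -- that both sides vanish.
  set f : ℝ × ℝ → ENNReal := {z : ℝ × ℝ | z.1 ^ 2 + z.2 ^ 2 < R ^ 2 ∧ z.1 ∈ Ioo (-R) R}.indicator
    (fun z => G z.1 * ENNReal.ofReal (w (z.1 ^ 2 + z.2 ^ 2))) with hf
  have hset : MeasurableSet {z : ℝ × ℝ | z.1 ^ 2 + z.2 ^ 2 < R ^ 2 ∧ z.1 ∈ Ioo (-R) R} :=
    by
    rw [ofPred_and]
    exact (measurableSet_lt (f := fun z : ℝ × ℝ => z.1 ^ 2 + z.2 ^ 2) (g := fun _ => R ^ 2)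
      (by fun_prop) (by fun_prop)).inter (measurable_fst measurableSet_Ioo)
  have hfm : Measurable f := by
    refine Measurable.indicator ?_ hset
    fun_prop
  have hcart : ∫⁻ z, f z = ∫⁻ p in Ioo (-R) R, G p *
      ∫⁻ q in Ioo (-√(R ^ 2 - p ^ 2)) √(R ^ 2 - p ^ 2), ENNReal.ofReal (w (p ^ 2 + q ^ 2)) := by
    rw [Measure.volume_eq_prod, lintegral_prod _ hfm.aemeasurable,
      ← lintegral_indicator measurableSet_Ioo]
    refine lintegral_congr fun p => ?_
    by_cases hp : p ∈ Ioo (-R) R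
    · rw [indicator_of_mem hp, ← lintegral_const_mul _ (by fun_prop),
        ← lintegral_indicator measurableSet_Ioo]
      refine lintegral_congr fun q => ?_
      by_cases hq : p ^ 2 + q ^ 2 < R ^ 2
      · rw [hf, indicator_of_mem (by exact ⟨hq, hp⟩), indicator_of_mem]
        rw [mem_Ioo, ← abs_lt]
        exact lt_sqrt_of_sq_lt (by rw [sq_abs]; linarith)
      · rw [hf, indicator_of_notMem (by exact fun h => hq h.1), indicator_of_notMem]
        rw [mem_Ioo, ← abs_lt, lt_sqrt (abs_nonneg q), sq_abs]
        intro h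
        exact hq (by linarith)
    · rw [indicator_of_notMem hp]
      refine (lintegral_congr fun q => ?_).trans lintegral_zero
      exact indicator_of_notMem (by exact fun h => hp h.2) _
  rw [← hcart, ← lintegral_comp_polarCoord_symm, polarCoord_target, Measure.volume_eq_prod,
    ← Measure.prod_restrict, lintegral_prod _ (by
      refine Measurable.aemeasurable ?_
      have := continuous_polarCoord_symm.measurable
      exact Measurable.smul (f := fun p : ℝ × ℝ => ENNReal.ofReal p.1) (by fun_prop)
        (hfm.comp this))]
  have hsub : Ioo 0 R = Iio R ∩ Ioi 0 := inter_comm _ _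
  rw [hsub, ← setLIntegral_indicator measurableSet_Iio]
  refine setLIntegral_congr_fun measurableSet_Ioi fun r hr => ?_
  have hr : (0 : ℝ) < r := hr
  by_cases hrR : r ∈ Iio R
  · have hrR' : r < R := hrR
    rw [indicator_of_mem hrR, ← lintegral_const_mul _ (by fun_prop)]
    refine lintegral_congr fun s => ?_
    have e : (r * cos s) ^ 2 + (r * sin s) ^ 2 = r ^ 2 := by
      linear_combination r ^ 2 * cos_sq_add_sin_sq s
    rw [polarCoord_symm_apply, hf, indicator_of_mem]
    · simp only [e, smul_eq_mul]
      rw [ENNReal.ofReal_mul hr.le]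
      ring
    · refine ⟨by simp only [e]; nlinarith, ?_⟩
      have h1 := neg_one_le_cos s
      have h2 := cos_le_one s
      constructor <;> simp only <;> nlinarith
  · rw [indicator_of_notMem hrR]
    symm
    refine (lintegral_congr fun s => ?_).trans lintegral_zero
    have e : (r * cos s) ^ 2 + (r * sin s) ^ 2 = r ^ 2 := by
      linear_combination r ^ 2 * cos_sq_add_sin_sq s
    rw [polarCoord_symm_apply, hf, indicator_of_notMem, smul_zero]
    rintro ⟨h, h'⟩
    simp only [e] at h
    have hr' : R ≤ r := not_lt.1 hrR
    have hR : 0 < R := by have := h'.1.trans h'.2; linarith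
    nlinarith

theorem lintegral_disc_abelWeight {R a : ℝ} (hR0 : 0 < R) (hR1 : R < 1) (ha0 : 0 ≤ a)
    (ha1 : a ≤ 1) {G : ℝ → ENNReal} (hG : Measurable G) :
    ∫⁻ r in Ioo 0 R, ENNReal.ofReal (r * abelWeight R a (r ^ 2)) *
      ∫⁻ s in Ioo (-π) π, G (r * cos s) =
    ∫⁻ p in Ioo (-R) R, G p * ENNReal.ofReal (π * (1 - a * √(1 - R ^ 2) / √(1 - p ^ 2))) := by
  rw [lintegral_disc (measurable_abelWeight R a) hG]
  refine setLIntegral_congr_fun measurableSet_Ioo fun p hp => ?_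
  rw [lintegral_abelWeight hR0 hR1 ha0 ha1 hp]

/-- The total mass of the circles. -/
theorem lintegral_mass {R a : ℝ} (hR0 : 0 < R) (hR1 : R < 1) (ha0 : 0 ≤ a) (ha1 : a ≤ 1) :
    (∫⁻ r in Ioo 0 R, ENNReal.ofReal (r * abelWeight R a (r ^ 2))) * ENNReal.ofReal (2 * π) =
    ENNReal.ofReal (2 * π * (R - a * √(1 - R ^ 2) * arcsin R)) := by
  have h := lintegral_disc_abelWeight hR0 hR1 ha0 ha1 (G := fun _ => 1) measurable_const
  have hv : ∫⁻ _ in Ioo (-π) π, (1 : ENNReal) = ENNReal.ofReal (2 * π) := by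
    simp [two_mul]
  simp only [hv, one_mul] at h
  rw [lintegral_mul_const _ (by have := measurable_abelWeight R a; fun_prop)] at h
  rw [h]
  have hle : -R ≤ R := by linarith
  have hder : ∀ p ∈ Icc (-R) R, HasDerivAt
      (fun p => π * (p - a * √(1 - R ^ 2) * arcsin p))
      (π * (1 - a * √(1 - R ^ 2) / √(1 - p ^ 2))) p := by
    intro p hp
    have h := ((hasDerivAt_id p).sub ((hasDerivAt_arcsin (x := p) (by linarith [hp.1])
      (by linarith [hp.2])).const_mul (a * √(1 - R ^ 2)))).const_mul π
    convert! h using 1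
    ring
  have hnn : ∀ p ∈ Ioo (-R) R, 0 ≤ π * (1 - a * √(1 - R ^ 2) / √(1 - p ^ 2)) := by
    intro p hp
    refine mul_nonneg pi_pos.le ?_
    have hp2 : p ^ 2 ≤ R ^ 2 := by nlinarith [hp.1, hp.2]
    have h0 : 0 < √(1 - p ^ 2) := sqrt_pos.2 (by nlinarith)
    rw [sub_nonneg, div_le_one h0]
    calc a * √(1 - R ^ 2) ≤ 1 * √(1 - R ^ 2) := by gcongr
      _ ≤ √(1 - p ^ 2) := by rw [one_mul]; exact sqrt_le_sqrt (by linarith)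
  have hcont : ContinuousOn (fun p => arcsin p) (Icc (-R) R) := continuous_arcsin.continuousOn
  have hint : IntervalIntegrable (fun p => π * (1 - a * √(1 - R ^ 2) / √(1 - p ^ 2))) volume
      (-R) R := by
    refine intervalIntegral.intervalIntegrable_deriv_of_nonneg
      (g := fun p => π * (p - a * √(1 - R ^ 2) * arcsin p)) ?_ ?_ ?_
    · exact Continuous.continuousOn (by fun_prop)
    · simpa [min_eq_left hle, max_eq_right hle] using
        fun p h1 h2 => hder p ⟨le_of_lt h1, le_of_lt h2⟩
    · simpa [min_eq_left hle, max_eq_right hle] using hnn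
  have hval := intervalIntegral.integral_eq_sub_of_hasDerivAt_of_le hle
    (Continuous.continuousOn (by fun_prop)) (fun p hp => hder p (Ioo_subset_Icc_self hp)) hint
  have hend : 2 * π * (R - a * √(1 - R ^ 2) * arcsin R) =
      ∫ p in (-R)..R, π * (1 - a * √(1 - R ^ 2) / √(1 - p ^ 2)) := by
    rw [hval, arcsin_neg]
    ring
  rw [hend, intervalIntegral.integral_of_le hle, integral_Ioc_eq_integral_Ioo,
    ofReal_integral_eq_lintegral_ofReal]
  · exact ((intervalIntegrable_iff_integrableOn_Ioo_of_le hle).1 hint)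
  · exact (ae_restrict_iff' measurableSet_Ioo).2 (.of_forall hnn)

end Abel

/-! ### Least lengths are at most the lengths of explicit curves. -/

section UpperBounds

open Set Complex

theorem length_nonneg {β : ℝ} (g : RiemannianMetric β) (c : ℝ → ℂ) : 0 ≤ length g c :=
  intervalIntegral.integral_nonneg zero_le_one fun _ _ => sqrt_nonneg _

theorem leastLength_le_of_mem {β : ℝ} (g : RiemannianMetric β) {T : Set (deckGroup β)}
    {γ : C(UnitAddCircle, KleinBottle β)} {c : ℝ → ℂ} {τ : deckGroup β} (hτ : τ ∈ T)
    (hγ : γ.Homotopic (deckLoop β τ)) (hc : IsRectifiableLift γ c) :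
    leastLength g T ≤ length g c := by
  refine csInf_le ⟨0, ?_⟩ ⟨γ, c, ⟨τ, hτ, hγ⟩, hc, rfl⟩
  rintro L ⟨γ, c, -, -, rfl⟩
  exact length_nonneg g c

/-- An affine deck transformation. -/
def IsAffineDeck {β : ℝ} (τ : deckGroup β) : Prop :=
  ∀ (z w : ℂ) (r : ℝ), τ • ((1 - r) * z + r * w) = (1 - r) * (τ • z) + r * (τ • w)

theorem σ_smul (β : ℝ) (z : ℂ) : σ β • z = (starRingEnd ℂ) z + π := rfl

theorem t_smul (β : ℝ) (z : ℂ) : t β • z = z + 2 * I * β := rfl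

theorem t_mul_σ_smul (β : ℝ) (z : ℂ) :
    (t β * σ β) • z = (starRingEnd ℂ) z + π + 2 * I * β := by
  rw [mul_smul, σ_smul, t_smul]

theorem σ_sq_smul (β : ℝ) (z : ℂ) : (σ β ^ 2) • z = z + 2 * π := by
  rw [pow_two, mul_smul, σ_smul, σ_smul]
  simp
  ring

theorem isAffineDeck_σ (β : ℝ) : IsAffineDeck (σ β) := by
  intro z w r
  simp only [σ_smul, map_add, map_mul, map_sub, map_one, conj_ofReal]
  ring

theorem isAffineDeck_t (β : ℝ) : IsAffineDeck (t β) := by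
  intro z w r
  simp only [t_smul]
  ring

theorem IsAffineDeck.mul {β : ℝ} {τ τ' : deckGroup β} (h : IsAffineDeck τ)
    (h' : IsAffineDeck τ') : IsAffineDeck (τ * τ') := by
  intro z w r
  simp only [mul_smul, h' z w r, h _ _ r]

/-- The closed curve of the Klein bottle covered by a path that is closed by a deck
transformation. -/
noncomputable def loopOf {β : ℝ} (τ : deckGroup β) (c : ℝ → ℂ) (hc : Continuous c)
    (h1 : c 1 = τ • c 0) : C(UnitAddCircle, KleinBottle β) where
  toFun := AddCircle.liftIco 1 0 fun s : ℝ => proj β (c s)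
  continuous_toFun := by
    refine AddCircle.liftIco_zero_continuous ?_ ?_
    · simp [h1, proj_smul]
    · exact ((continuous_proj β).comp hc).continuousOn

theorem liftIco_zero_coe_of_mem_Icc {B : Type*} {f : ℝ → B} (h : f 0 = f 1) {s : ℝ}
    (hs : s ∈ Icc (0 : ℝ) 1) : AddCircle.liftIco 1 0 f (s : UnitAddCircle) = f s := by
  rcases eq_or_lt_of_le hs.2 with rfl | h1
  · have : ((1 : ℝ) : UnitAddCircle) = ((0 : ℝ) : UnitAddCircle) := by
      rw [AddCircle.coe_period, QuotientAddGroup.mk_zero]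
    rw [this, AddCircle.liftIco_coe_apply (by simp), h]
  · exact AddCircle.liftIco_coe_apply (by simpa using ⟨hs.1, h1⟩)

theorem loopOf_coe {β : ℝ} (τ : deckGroup β) (c : ℝ → ℂ) (hc : Continuous c)
    (h1 : c 1 = τ • c 0) {s : ℝ} (hs : s ∈ Icc (0 : ℝ) 1) :
    loopOf τ c hc h1 (s : UnitAddCircle) = proj β (c s) :=
  liftIco_zero_coe_of_mem_Icc (f := fun s : ℝ => proj β (c s)) (by simp [h1, proj_smul]) hs

theorem deckLoop_coe {β : ℝ} (τ : deckGroup β) {s : ℝ} (hs : s ∈ Icc (0 : ℝ) 1) :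
    deckLoop β τ (s : UnitAddCircle) = proj β ((s : ℂ) * (τ • (0 : ℂ))) :=
  liftIco_zero_coe_of_mem_Icc (f := fun s : ℝ => proj β ((s : ℂ) * (τ • (0 : ℂ))))
    (by simp [proj_smul]) hs

theorem exists_mem_Icc_coe_eq (x : UnitAddCircle) : ∃ s ∈ Icc (0 : ℝ) 1, (s : UnitAddCircle) = x :=
  have ⟨s, hs, h⟩ := AddCircle.coe_image_Icc_eq (1 : ℝ) 0 ▸ mem_univ x
  ⟨s, by simpa using hs, h⟩

/-- The straight-line homotopy in the plane to the segment from $0$ to $\tau 0$ commutes with $\tau$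
because $\tau$ is affine, so it descends to a homotopy of loops. -/
theorem loopOf_homotopic {β : ℝ} {τ : deckGroup β} (hτ : IsAffineDeck τ) (c : ℝ → ℂ)
    (hc : Continuous c) (h1 : c 1 = τ • c 0) :
    (loopOf τ c hc h1).Homotopic (deckLoop β τ) := by
  let H : C(ℝ × unitInterval, KleinBottle β) :=
    ⟨fun p => proj β ((1 - (p.2 : ℝ)) * c p.1 + (p.2 : ℝ) * (p.1 * (τ • (0 : ℂ)))),
      (continuous_proj β).comp (by fun_prop)⟩
  have hend : H.curry 0 = H.curry 1 := by
    ext r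
    have e : (1 - ((r : ℝ) : ℂ)) * c 1 + ((r : ℝ) : ℂ) * (((1 : ℝ) : ℂ) * (τ • (0 : ℂ))) =
        τ • ((1 - ((r : ℝ) : ℂ)) * c 0 + ((r : ℝ) : ℂ) * (((0 : ℝ) : ℂ) * (τ • (0 : ℂ)))) := by
      rw [h1, hτ]
      simp
    change proj β _ = proj β _
    simp only
    rw [e, proj_smul]
  -- Currying reduces continuity on circle × interval to that of a path of paths with equal ends.
  let F : C(UnitAddCircle, C(unitInterval, KleinBottle β)) :=
    ⟨AddCircle.liftIco 1 0 H.curry,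
      AddCircle.liftIco_zero_continuous (by simpa using hend) H.curry.continuous.continuousOn⟩
  have hF : ∀ s ∈ Icc (0 : ℝ) 1, F (s : UnitAddCircle) = H.curry s := fun s hs =>
    liftIco_zero_coe_of_mem_Icc hend hs
  refine ⟨{ toFun := fun p => F p.2 p.1, continuous_toFun := ?_, map_zero_left := ?_,
            map_one_left := ?_ }⟩
  · exact F.uncurry.continuous.comp continuous_swap
  · intro x
    obtain ⟨s, hs, rfl⟩ := exists_mem_Icc_coe_eq x
    rw [loopOf_coe τ c hc h1 hs]
    simp only [hF s hs]
    simp [H]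
  · intro x
    obtain ⟨s, hs, rfl⟩ := exists_mem_Icc_coe_eq x
    rw [deckLoop_coe τ hs]
    simp only [hF s hs]
    simp [H]

/-- `q` is a conformal factor of the metric, that is, `g = q² g_β`. -/
structure IsConformalFactor {β : ℝ} (g : RiemannianMetric β) (q : ℂ → ℝ) : Prop where
  continuous : Continuous q
  pos : ∀ z, 0 < q z
  inner_eq : ∀ z v w, g.inner z v w = q z ^ 2 * (v.re * w.re + v.im * w.im)
  conj_add_pi : ∀ z, q ((starRingEnd ℂ) z + π) = q z
  add_period : ∀ z, q (z + 2 * I * β) = q z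

theorem flatMetric_inner {β : ℝ} (z v w : ℂ) :
    (flatMetric β).inner z v w = v.re * w.re + v.im * w.im := by
  change inner ℝ v w = _
  simp only [Complex.inner, mul_re, conj_re, conj_im]
  ring

theorem IsConformalTo.exists_factor {β : ℝ} {g : RiemannianMetric β}
    (h : IsConformalTo g (flatMetric β)) : ∃ q, IsConformalFactor g q := by
  obtain ⟨c, hc, hg⟩ := h
  simp only [flatMetric_inner] at hg
  have hc1 : ∀ z, g.inner z 1 1 = c z := fun z => by simp [hg]
  refine ⟨fun z => √(c z), ?_, fun z => sqrt_pos.2 (hc z), ?_, ?_, ?_⟩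
  · refine Continuous.sqrt ?_
    have h1 : c = fun z => g.inner z 1 1 := funext fun z => (hc1 z).symm
    have := g.continuous
    rw [h1]
    fun_prop
  · intro z v w
    rw [hg, sq_sqrt (hc z).le]
  · intro z
    have := g.glide_invariant z 1 1
    rw [map_one, hc1, hc1] at this
    exact congrArg _ this
  · intro z
    have := g.vert_invariant z 1 1
    rw [hc1, hc1] at this
    exact congrArg _ this

theorem IsConformalFactor.isConformalTo {β : ℝ} {g : RiemannianMetric β} {q : ℂ → ℝ}
    (h : IsConformalFactor g q) : IsConformalTo g (flatMetric β) :=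
  ⟨fun z => q z ^ 2, fun z => pow_pos (h.pos z) 2, fun z v w => by
    rw [h.inner_eq, flatMetric_inner]⟩

theorem IsConformalFactor.sqrt_inner {β : ℝ} {g : RiemannianMetric β} {q : ℂ → ℝ}
    (h : IsConformalFactor g q) (z v : ℂ) : √(g.inner z v v) = q z * ‖v‖ := by
  rw [h.inner_eq, ← pow_two, ← pow_two, ← normSq_add_mul_I, re_add_im, normSq_eq_norm_sq,
    ← mul_pow, sqrt_sq (mul_nonneg (h.pos z).le (norm_nonneg v))]

/-- A continuously differentiable path closed by a deck transformation, after an affine change of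
parameter, is a rectifiable lift of a loop in the class of this transformation. -/
theorem IsConformalFactor.exists_rectifiableLift {β : ℝ} {g : RiemannianMetric β} {q : ℂ → ℝ}
    (h : IsConformalFactor g q) {τ : deckGroup β}
    (hτ : IsAffineDeck τ) {a b : ℝ} (hab : a < b) {e e' : ℝ → ℂ}
    (he : ∀ s, HasDerivAt e (e' s) s) (he' : Continuous e') (hend : e b = τ • e a) :
    ∃ γ : C(UnitAddCircle, KleinBottle β), ∃ c : ℝ → ℂ, γ.Homotopic (deckLoop β τ) ∧
      IsRectifiableLift γ c ∧ length g c = ∫ s in a..b, q (e s) * ‖e' s‖ := by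
  have hd : ∀ s, HasDerivAt (fun s : ℝ => e (a + (b - a) * s)) ((b - a : ℝ) * e' (a + (b - a) * s))
      s := by
    intro s
    have h1 : HasDerivAt (fun s : ℝ => a + (b - a) * s) (b - a) s := by
      simpa using ((hasDerivAt_id s).const_mul (b - a)).const_add a
    have h2 := (he (a + (b - a) * s)).scomp s h1
    rw [real_smul] at h2
    exact h2
  have hcd : ContDiff ℝ 1 (fun s : ℝ => e (a + (b - a) * s)) := by
    rw [contDiff_one_iff_deriv]
    refine ⟨fun s => (hd s).differentiableAt, ?_⟩
    rw [funext fun s => (hd s).deriv]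
    fun_prop
  have h1 : (fun s : ℝ => e (a + (b - a) * s)) 1 = τ • (fun s : ℝ => e (a + (b - a) * s)) 0 := by
    simpa using hend
  refine ⟨loopOf τ _ hcd.continuous h1, fun s => e (a + (b - a) * s), loopOf_homotopic hτ _ hcd.continuous h1, ⟨?_, ?_⟩, ?_⟩
  · exact hcd.locallyLipschitz.locallyLipschitzOn.exists_lipschitzOnWith_of_compact isCompact_Icc
  · exact fun s hs => (loopOf_coe τ _ hcd.continuous h1 hs).symm
  · have hpos : 0 < b - a := sub_pos.2 hab
    have := intervalIntegral.mul_integral_comp_add_mul (a := 0) (b := 1)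
      (f := fun s => q (e s) * ‖e' s‖) (c := b - a) a
    simp only [mul_zero, add_zero, mul_one, add_sub_cancel] at this
    rw [← this, length, ← intervalIntegral.integral_const_mul]
    refine intervalIntegral.integral_congr fun s _ => ?_
    rw [h.sqrt_inner, (hd s).deriv, norm_mul, norm_real, norm_of_nonneg hpos.le]
    ring

theorem IsConformalFactor.leastLength_le {β : ℝ} {g : RiemannianMetric β} {q : ℂ → ℝ}
    (h : IsConformalFactor g q) {T : Set (deckGroup β)} {τ : deckGroup β} (hT : τ ∈ T)
    (hτ : IsAffineDeck τ) {a b : ℝ} (hab : a < b) {e e' : ℝ → ℂ}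
    (he : ∀ s, HasDerivAt e (e' s) s) (he' : Continuous e') (hend : e b = τ • e a) :
    leastLength g T ≤ ∫ s in a..b, q (e s) * ‖e' s‖ := by
  obtain ⟨γ, c, hγ, hc, hl⟩ := h.exists_rectifiableLift hτ hab he he' hend
  exact hl ▸ leastLength_le_of_mem g hT hγ hc

end UpperBounds

/-! ### The function `artanh`, which sends the sine of the latitude to the Mercator ordinate. -/

section Artanh

open Set

theorem hasDerivAt_artanh {x : ℝ} (hx : x ∈ Ioo (-1) 1) :
    HasDerivAt artanh (1 / (1 - x ^ 2)) x := by
  have h1 : 0 < 1 + x := by linarith [hx.1]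
  have h2 : 0 < 1 - x := by linarith [hx.2]
  have hd : HasDerivAt (fun x : ℝ => 1 / 2 * log ((1 + x) / (1 - x))) (1 / (1 - x ^ 2)) x := by
    have h := (((((hasDerivAt_id x).const_add 1).div ((hasDerivAt_id x).const_sub 1)
      h2.ne').log (div_pos h1 h2).ne').const_mul (1 / 2))
    convert! h using 1
    have h3 : 1 - x ^ 2 ≠ 0 := by nlinarith
    simp only [Pi.div_apply, id]
    field_simp
    ring
  refine hd.congr_of_eventuallyEq ?_
  filter_upwards [Ioo_mem_nhds hx.1 hx.2] with y hy
  exact artanh_eq_half_log (Ioo_subset_Icc_self hy)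

theorem measurable_artanh : Measurable artanh := by
  unfold artanh
  fun_prop

theorem artanh_neg_eq (x : ℝ) : artanh (-x) = -artanh x := by
  rw [artanh, artanh, ← log_inv, ← sqrt_inv, inv_div]
  congr 3
  ring

theorem mul_cos_mem_Ioo {r : ℝ} (hr : r ∈ Ioo (0 : ℝ) 1) (s : ℝ) : r * cos s ∈ Ioo (-1 : ℝ) 1 := by
  rw [mem_Ioo, ← abs_lt, abs_mul, abs_of_pos hr.1]
  have := abs_cos_le_one s
  nlinarith [hr.1, hr.2, abs_nonneg (cos s)]

theorem one_sub_sq_pos {p : ℝ} (hp : p ∈ Ioo (-1 : ℝ) 1) : 0 < 1 - p ^ 2 := by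
  nlinarith [hp.1, hp.2]

theorem continuous_artanh_mul_cos {r : ℝ} (hr : r ∈ Ioo (0 : ℝ) 1) :
    Continuous fun s => artanh (r * cos s) :=
  continuous_iff_continuousAt.2 fun s =>
    (hasDerivAt_artanh (mul_cos_mem_Ioo hr s)).continuousAt.comp (f := fun s => r * cos s)
      (by fun_prop)

end Artanh

/-! ### Great circles mixed over the spherical zone. -/

section ZoneInequality

open MeasureTheory Set

/-- If all the great circles of slope less than `ω` have length at least `L` for the conformal
factor `Ψ` that depends on the latitude, then so does their mixture. -/
theorem zone_inequality {Ψ : ℝ → ℝ} (hΨ : Continuous Ψ) (hΨ0 : ∀ y, 0 ≤ Ψ y)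
    (hΨe : ∀ y, Ψ (-y) = Ψ y) {L : ℝ} (hL0 : 0 ≤ L)
    (hL : ∀ r ∈ Ioo (0 : ℝ) 1,
      L ≤ ∫ s in (0 : ℝ)..π, Ψ (artanh (r * cos s)) / √(1 - (r * cos s) ^ 2))
    {R a : ℝ} (hR0 : 0 < R) (hR1 : R < 1) (ha0 : 0 ≤ a) (ha1 : a ≤ 1) :
    L * (R - a * √(1 - R ^ 2) * arcsin R) ≤
      π * ∫ y in (0 : ℝ)..artanh R, Ψ y * (1 / cosh y - a * √(1 - R ^ 2)) := by
  set A := a * √(1 - R ^ 2) with hA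
  set G : ℝ → ENNReal := fun p => ENNReal.ofReal (Ψ (artanh p) / √(1 - p ^ 2)) with hG
  have hGm : Measurable G := by
    have h1 := hΨ.measurable.comp measurable_artanh
    exact (h1.div (by fun_prop)).ennreal_ofReal
  have hmain := lintegral_disc_abelWeight hR0 hR1 ha0 ha1 hGm
  -- A full circle is two half circles, exchanged by $s\mapsto-s$: hence the factor 2.
  have hinner : ∀ r ∈ Ioo 0 R, ENNReal.ofReal (2 * L) ≤ ∫⁻ s in Ioo (-π) π, G (r * cos s) := by
    intro r hr
    have hr' : r ∈ Ioo (0 : ℝ) 1 := ⟨hr.1, hr.2.trans hR1⟩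
    have hc : Continuous fun s => Ψ (artanh (r * cos s)) / √(1 - (r * cos s) ^ 2) := by
      refine Continuous.div (hΨ.comp (continuous_artanh_mul_cos hr')) (by fun_prop) fun s => ?_
      exact (sqrt_pos.2 (one_sub_sq_pos (mul_cos_mem_Ioo hr' s))).ne'
    have hpi : -π ≤ π := by linarith [pi_pos]
    have h2 : 2 * L ≤ ∫ s in (-π)..π, Ψ (artanh (r * cos s)) / √(1 - (r * cos s) ^ 2) := by
      rw [← intervalIntegral.integral_add_adjacent_intervals (b := 0)
        (hc.intervalIntegrable _ _) (hc.intervalIntegrable _ _)]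
      have h3 := intervalIntegral.integral_comp_neg (a := 0) (b := π)
        fun s => Ψ (artanh (r * cos s)) / √(1 - (r * cos s) ^ 2)
      simp only [cos_neg, neg_zero] at h3
      rw [← h3]
      linarith [hL r hr']
    refine (ENNReal.ofReal_le_ofReal h2).trans_eq ?_
    rw [intervalIntegral.integral_of_le hpi, integral_Ioc_eq_integral_Ioo,
      ofReal_integral_eq_lintegral_ofReal]
    · exact (hc.integrableOn_Icc).mono_set Ioo_subset_Icc_self
    · exact .of_forall fun s => div_nonneg (hΨ0 _) (sqrt_nonneg _)
  have hlow : ENNReal.ofReal (2 * L) *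
      ∫⁻ r in Ioo 0 R, ENNReal.ofReal (r * abelWeight R a (r ^ 2)) ≤
      ∫⁻ p in Ioo (-R) R, G p * ENNReal.ofReal (π * (1 - A / √(1 - p ^ 2))) := by
    rw [← hmain, ← lintegral_const_mul _ (by have := measurable_abelWeight R a; fun_prop)]
    refine setLIntegral_mono' measurableSet_Ioo fun r hr => ?_
    rw [mul_comm]
    gcongr
    exact hinner r hr
  have hRn : -R ≤ R := by linarith
  have hsub : Icc (-R) R ⊆ Ioo (-1) 1 := Icc_subset_Ioo (by linarith) hR1
  have hart : ContinuousOn artanh (Icc (-R) R) := fun p hp =>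
    (hasDerivAt_artanh (hsub hp)).continuousAt.continuousWithinAt
  have hsq : ∀ p ∈ Icc (-R) R, √(1 - p ^ 2) ≠ 0 := fun p hp =>
    (sqrt_pos.2 (one_sub_sq_pos (hsub hp))).ne'
  have hup : ∫⁻ p in Ioo (-R) R, G p * ENNReal.ofReal (π * (1 - A / √(1 - p ^ 2))) =
      ENNReal.ofReal (2 * (π * ∫ y in (0 : ℝ)..artanh R, Ψ y * (1 / cosh y - A))) := by
    have hge : Continuous fun y => Ψ y * (1 / cosh y - A) :=
      hΨ.mul ((continuous_const.div continuous_cosh fun y => (cosh_pos y).ne').sub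
        continuous_const)
    -- Substitution $p=\tanh y$: $dp=(1-p^2)\,dy$ and $\sqrt{1-p^2}=1/\cosh y$. Evenness of $\Psi$
    -- folds the interval.
    have hsubst : ∫ p in (-R)..R, π * (Ψ (artanh p) / √(1 - p ^ 2) * (1 - A / √(1 - p ^ 2))) =
        2 * (π * ∫ y in (0 : ℝ)..artanh R, Ψ y * (1 / cosh y - A)) := by
      have h1 := intervalIntegral.integral_comp_mul_deriv'' (a := -R) (b := R) (f := artanh)
        (f' := fun p => 1 / (1 - p ^ 2)) (g := fun y => Ψ y * (1 / cosh y - A))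
        (by rwa [uIcc_of_le hRn])
        (by
          intro p hp
          rw [min_eq_left hRn, max_eq_right hRn] at hp
          exact (hasDerivAt_artanh (hsub (Ioo_subset_Icc_self hp))).hasDerivWithinAt)
        (by
          rw [uIcc_of_le hRn]
          exact continuousOn_const.div (by fun_prop) fun p hp =>
            (one_sub_sq_pos (hsub hp)).ne')
        hge.continuousOn
      have h2 := intervalIntegral.integral_comp_neg (a := 0) (b := artanh R)
        fun y => Ψ y * (1 / cosh y - A)
      simp only [cosh_neg, neg_zero, hΨe] at h2
      rw [artanh_neg_eq, ← intervalIntegral.integral_add_adjacent_intervals (b := 0)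
        (hge.intervalIntegrable _ _) (hge.intervalIntegrable _ _), ← h2] at h1
      rw [intervalIntegral.integral_const_mul, ← mul_assoc, mul_comm 2 π, mul_assoc, two_mul, ← h1]
      congr 1
      refine intervalIntegral.integral_congr fun p hp => ?_
      rw [uIcc_of_le hRn] at hp
      have h0 := sqrt_pos.2 (one_sub_sq_pos (hsub hp))
      have h00 := sq_sqrt (one_sub_sq_pos (hsub hp)).le
      have e : 1 / (1 - p ^ 2) = 1 / √(1 - p ^ 2) ^ 2 := by rw [h00]
      simp only [Function.comp, cosh_artanh (hsub hp)]
      rw [e]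
      field_simp
    rw [← hsubst, intervalIntegral.integral_of_le hRn, integral_Ioc_eq_integral_Ioo,
      ofReal_integral_eq_lintegral_ofReal]
    · refine setLIntegral_congr_fun measurableSet_Ioo fun p hp => ?_
      simp only [hG]
      rw [← ENNReal.ofReal_mul (div_nonneg (hΨ0 _) (sqrt_nonneg _))]
      congr 1
      ring
    · refine IntegrableOn.mono_set (t := Icc (-R) R) ?_ Ioo_subset_Icc_self
      refine ContinuousOn.integrableOn_Icc ?_
      refine continuousOn_const.mul (ContinuousOn.mul (ContinuousOn.div
        (hΨ.comp_continuousOn hart) (by fun_prop) hsq) (continuousOn_const.sub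
          (continuousOn_const.div (by fun_prop) hsq)))
    · refine (ae_restrict_iff' measurableSet_Ioo).2 (.of_forall fun p hp => ?_)
      refine mul_nonneg pi_pos.le (mul_nonneg (div_nonneg (hΨ0 _) (sqrt_nonneg _)) ?_)
      have hp2 : p ^ 2 ≤ R ^ 2 := by nlinarith [hp.1, hp.2]
      have h0 := sqrt_pos.2 (one_sub_sq_pos (hsub (Ioo_subset_Icc_self hp)))
      rw [sub_nonneg, div_le_one h0]
      calc a * √(1 - R ^ 2) ≤ 1 * √(1 - R ^ 2) := by gcongr
        _ ≤ √(1 - p ^ 2) := by rw [one_mul]; exact sqrt_le_sqrt (by linarith)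
  rw [hup] at hlow
  have hmul := mul_le_mul_left hlow (ENNReal.ofReal (2 * π))
  rw [mul_assoc, lintegral_mass hR0 hR1 ha0 ha1, ← ENNReal.ofReal_mul (by positivity),
    ← ENNReal.ofReal_mul' (by positivity)] at hmul
  -- Nonnegativity is what allows returning from `ENNReal` to real numbers. The density is
  -- nonnegative since $\cosh y\le\cosh(\operatorname{artanh}R)=1/\sqrt{1-R^2}$ and $a\le1$.
  have hI : 0 ≤ ∫ y in (0 : ℝ)..artanh R, Ψ y * (1 / cosh y - A) := by
    refine intervalIntegral.integral_nonneg (artanh_nonneg hR0.le) fun y hy => ?_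
    refine mul_nonneg (hΨ0 y) ?_
    have h1 : cosh y ≤ 1 / √(1 - R ^ 2) := by
      rw [← cosh_artanh ⟨by linarith, hR1⟩, cosh_le_cosh, abs_of_nonneg hy.1,
        abs_of_nonneg (artanh_nonneg hR0.le)]
      exact hy.2
    have h0 : 0 < √(1 - R ^ 2) := sqrt_pos.2 (by nlinarith)
    rw [le_div_iff₀ h0] at h1
    rw [sub_nonneg, le_div_iff₀ (cosh_pos y)]
    calc A * cosh y = a * (cosh y * √(1 - R ^ 2)) := by rw [hA]; ring
      _ ≤ 1 * 1 := by gcongr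
      _ = 1 := one_mul 1
  rw [ENNReal.ofReal_le_ofReal_iff (by positivity)] at hmul
  have : 0 < 4 * π := by positivity
  nlinarith

end ZoneInequality

/-! ### Horizontal averages of the conformal factor, and the curves of the three classes. -/

section Averages

open MeasureTheory Set Complex

theorem intervalIntegral_swap {F : ℝ → ℝ → ℝ} (hF : Continuous (Function.uncurry F)) {a b c d : ℝ}
    (hab : a ≤ b) (hcd : c ≤ d) :
    ∫ x in a..b, ∫ y in c..d, F x y = ∫ y in c..d, ∫ x in a..b, F x y := by
  refine intervalIntegral_intervalIntegral_swap ?_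
  rw [uIoc_of_le hab, uIoc_of_le hcd]
  exact (hF.continuousOn.integrableOn_compact (isCompact_Icc.prod isCompact_Icc)).mono_set
    (prod_mono Ioc_subset_Icc_self Ioc_subset_Icc_self)

/-- The integral of a function on the plane over a horizontal segment of length `2 π`. -/
noncomputable def mean (q : ℂ → ℝ) (y : ℝ) : ℝ := ∫ x in (-π)..π, q (x + y * I)

theorem continuous_mean {q : ℂ → ℝ} (hq : Continuous q) : Continuous (mean q) :=
  intervalIntegral.continuous_parametric_intervalIntegral_of_continuous'
    (f := fun y x : ℝ => q (x + y * I)) (by fun_prop) _ _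

section Factor

variable {β : ℝ} {g : RiemannianMetric β} {q : ℂ → ℝ} (h : IsConformalFactor g q)
include h

theorem IsConformalFactor.add_two_pi (z : ℂ) : q (z + 2 * π) = q z := by
  rw [← h.conj_add_pi z, ← h.conj_add_pi ((starRingEnd ℂ) z + π)]
  simp only [map_add, conj_conj, conj_ofReal]
  ring_nf

theorem IsConformalFactor.mean_shift (y u : ℝ) :
    ∫ x in (-π)..π, q (x + u + y * I) = mean q y := by
  have hp : Function.Periodic (fun x : ℝ => q (x + y * I)) (2 * π) := fun x => by
    simp only
    rw [← h.add_two_pi (x + y * I)]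
    push_cast
    ring_nf
  have h1 := hp.intervalIntegral_add_eq (-π + u) (-π)
  have h2 := intervalIntegral.integral_comp_add_right (a := -π) (b := π)
    (fun x : ℝ => q (x + y * I)) u
  rw [show -π + 2 * π = π by ring, show -π + u + 2 * π = π + u by ring] at h1
  rw [mean, ← h1, ← h2]
  simp only [ofReal_add]

/-- The glide reflection exchanges the parallels at heights $y$ and $-y$; the shift by $\pi$ is
absorbed by periodicity. -/
theorem IsConformalFactor.mean_neg (y : ℝ) : mean q (-y) = mean q y := by
  rw [← h.mean_shift (-y) π, mean]
  refine intervalIntegral.integral_congr fun x _ => ?_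
  have := h.conj_add_pi (x + y * I)
  simp only [map_add, map_mul, conj_ofReal, conj_I] at this
  rw [← this]
  push_cast
  ring_nf

theorem IsConformalFactor.mean_add_period (y : ℝ) : mean q (y + 2 * β) = mean q y := by
  refine intervalIntegral.integral_congr fun x _ => ?_
  have := h.add_period (x + y * I)
  rw [← this]
  push_cast
  ring_nf

theorem IsConformalFactor.mean_pos (y : ℝ) : 0 < mean q y := by
  refine intervalIntegral.intervalIntegral_pos_of_pos ?_ (fun x => h.pos _)
    (by linarith [pi_pos])
  have := h.continuous
  exact Continuous.intervalIntegrable (by fun_prop) _ _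

theorem IsConformalFactor.lHor_le (y : ℝ) : lHor g ≤ mean q y := by
  have := h.leastLength_le (T := {σ β ^ 2}) (mem_singleton _)
    (pow_two (σ β) ▸ (isAffineDeck_σ β).mul (isAffineDeck_σ β)) (a := -π) (b := π)
    (by linarith [pi_pos]) (e := fun s => s + y * I) (e' := fun _ => 1)
    (fun s => (ofRealCLM.hasDerivAt (x := s)).add_const _) continuous_const (by
      rw [σ_sq_smul]
      push_cast
      ring)
  simpa [lHor, mean] using this

theorem IsConformalFactor.lVert_le (hβ : 0 < β) (x : ℝ) :
    lVert g ≤ ∫ y in (-β)..β, q (x + y * I) := by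
  have := h.leastLength_le (T := {t β}) (mem_singleton _) (isAffineDeck_t β) (a := -β) (b := β)
    (by linarith) (e := fun s => x + s * I) (e' := fun _ => I)
    (fun s => by simpa using ((ofRealCLM.hasDerivAt (x := s)).mul_const I).const_add (x : ℂ))
    continuous_const (by
      rw [t_smul]
      push_cast
      ring)
  simpa [lVert] using this

theorem IsConformalFactor.two_pi_mul_lVert_le (hβ : 0 < β) :
    2 * π * lVert g ≤ ∫ y in (-β)..β, mean q y := by
  have hc := h.continuous
  have hpi : -π ≤ π := by linarith [pi_pos]
  have h1 : ∫ _ in (-π)..π, lVert g ≤ ∫ x in (-π)..π, ∫ y in (-β)..β, q (x + y * I) := by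
    refine intervalIntegral.integral_mono_on hpi (by simp) ?_ fun x _ => h.lVert_le hβ x
    refine Continuous.intervalIntegrable ?_ _ _
    exact intervalIntegral.continuous_parametric_intervalIntegral_of_continuous'
      (f := fun x y : ℝ => q (x + y * I)) (by fun_prop) _ _
  rw [intervalIntegral_swap (F := fun x y : ℝ => q (x + y * I)) (by fun_prop) hpi (by linarith)]
    at h1
  simp only [intervalIntegral.integral_const, smul_eq_mul] at h1
  calc _ = _ := by ring
    _ ≤ _ := h1

end Factor

/-- The longitude along a great circle. -/
noncomputable def longitude (k s : ℝ) : ℝ :=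
  s + Real.arctan ((1 - k) * (Real.sin s * Real.cos s) / (k * Real.cos s ^ 2 + Real.sin s ^ 2))

theorem longitude_zero (k : ℝ) : longitude k 0 = 0 := by simp [longitude]

theorem longitude_pi (k : ℝ) : longitude k π = π := by simp [longitude]

theorem mul_cos_sq_add_sin_sq_pos {k : ℝ} (hk : 0 < k) (s : ℝ) :
    0 < k * Real.cos s ^ 2 + Real.sin s ^ 2 := by
  have := Real.sin_sq_add_cos_sq s
  rcases eq_or_ne (Real.sin s) 0 with h0 | h0
  · have : Real.cos s ^ 2 = 1 := by rw [h0] at this; linarith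
    rw [this, h0]
    linarith
  · positivity

/-- The longitude $\lambda$ satisfies $\tan\lambda=\tan s/k$. The definition uses the formula for
$\tan(\lambda-s)$, whose denominator never vanishes, so the branch is smooth across $s=\pi/2$. -/
theorem hasDerivAt_longitude {k : ℝ} (hk : 0 < k) (s : ℝ) :
    HasDerivAt (longitude k) (k / (k ^ 2 * Real.cos s ^ 2 + Real.sin s ^ 2)) s := by
  have hD := mul_cos_sq_add_sin_sq_pos hk s
  have hD2 := mul_cos_sq_add_sin_sq_pos (pow_pos hk 2) s
  have hsc := Real.sin_sq_add_cos_sq s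
  have h1 : HasDerivAt (fun s => (1 - k) * (Real.sin s * Real.cos s))
      ((1 - k) * (Real.cos s * Real.cos s + Real.sin s * -Real.sin s)) s :=
    ((Real.hasDerivAt_sin s).mul (Real.hasDerivAt_cos s)).const_mul (1 - k)
  have h2 : HasDerivAt (fun s => k * Real.cos s ^ 2 + Real.sin s ^ 2)
      (2 * (1 - k) * (Real.sin s * Real.cos s)) s := by
    have := (((Real.hasDerivAt_cos s).pow 2).const_mul k).add ((Real.hasDerivAt_sin s).pow 2)
    convert! this using 1
    simp
    ring
  have h3 := (hasDerivAt_id s).add ((h1.div h2 hD.ne').arctan)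
  convert! h3 using 1
  simp only [Pi.div_apply]
  generalize Real.sin s = x at *
  generalize Real.cos s = y at *
  have e : 1 + ((1 - k) * (x * y) / (k * y ^ 2 + x ^ 2)) ^ 2 =
      (k ^ 2 * y ^ 2 + x ^ 2) / (k * y ^ 2 + x ^ 2) ^ 2 := by
    field_simp
    have hx : x ^ 2 = 1 - y ^ 2 := by linarith
    linear_combination (k ^ 2 * y ^ 2 + x ^ 2) * hsc
  rw [e]
  field_simp
  linear_combination (-k - k * (x ^ 2 + y ^ 2) + k ^ 2 * y ^ 2 + x ^ 2) * hsc

/-- A half great circle of the zone `√(1 - r²) < cos`, in the coordinates of Mercator. -/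
theorem hasDerivAt_halfCircle {r : ℝ} (hr : r ∈ Ioo (0 : ℝ) 1) (x₀ δ s : ℝ) :
    HasDerivAt (fun s : ℝ => (x₀ + longitude √(1 - r ^ 2) s +
        ((artanh (r * Real.cos s) + δ : ℝ) : ℂ) * I : ℂ))
      ((√(1 - r ^ 2) / (1 - (r * Real.cos s) ^ 2) : ℝ) +
        ((-(r * Real.sin s) / (1 - (r * Real.cos s) ^ 2) : ℝ) : ℂ) * I) s := by
  have hr2 : 0 < 1 - r ^ 2 := by nlinarith [hr.1, hr.2]
  have h1 := (hasDerivAt_longitude (sqrt_pos.2 hr2) s).ofReal_comp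
  have h2 : HasDerivAt (fun s => artanh (r * Real.cos s) + δ)
      (-(r * Real.sin s) / (1 - (r * Real.cos s) ^ 2)) s := by
    have h := ((hasDerivAt_artanh (mul_cos_mem_Ioo hr s)).comp s
      ((Real.hasDerivAt_cos s).const_mul r)).add_const δ
    convert! h using 1
    ring
  have e : √(1 - r ^ 2) ^ 2 * Real.cos s ^ 2 + Real.sin s ^ 2 = 1 - (r * Real.cos s) ^ 2 := by
    rw [sq_sqrt hr2.le]
    linear_combination Real.sin_sq_add_cos_sq s
  rw [e] at h1
  exact (h1.const_add (x₀ : ℂ)).add (h2.ofReal_comp.mul_const I)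

theorem norm_deriv_halfCircle {r : ℝ} (hr : r ∈ Ioo (0 : ℝ) 1) (s : ℝ) :
    ‖((√(1 - r ^ 2) / (1 - (r * Real.cos s) ^ 2) : ℝ) +
        ((-(r * Real.sin s) / (1 - (r * Real.cos s) ^ 2) : ℝ) : ℂ) * I : ℂ)‖ =
      1 / √(1 - (r * Real.cos s) ^ 2) := by
  have hr2 : 0 < 1 - r ^ 2 := by nlinarith [hr.1, hr.2]
  have hp := one_sub_sq_pos (mul_cos_mem_Ioo hr s)
  rw [norm_add_mul_I, ← Real.sqrt_one, ← Real.sqrt_div zero_le_one, Real.sqrt_one]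
  congr 1
  have e : 1 - r ^ 2 + (-(r * Real.sin s)) ^ 2 = 1 - (r * Real.cos s) ^ 2 := by
    linear_combination r ^ 2 * Real.sin_sq_add_cos_sq s
  rw [div_pow, div_pow, sq_sqrt hr2.le, ← add_div, e]
  generalize 1 - (r * Real.cos s) ^ 2 = P at hp ⊢
  field_simp

section Factor

variable {β : ℝ} {g : RiemannianMetric β} {q : ℂ → ℝ} (h : IsConformalFactor g q)
include h

/-- The half circle about the axis $y=\delta$ runs from height $\delta+\operatorname{artanh}r$ to
$\delta-\operatorname{artanh}r$ while the longitude grows by $\pi$, so $\tau$ closes it. On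
averaging over the initial longitude $x_0$, the longitude along the curve disappears by
`mean_shift`. -/
theorem IsConformalFactor.two_pi_mul_lSigma_le_of_mem {τ : deckGroup β}
    (hτ : τ ∈ ({σ β, t β * σ β} : Set (deckGroup β))) {δ : ℝ}
    (hτδ : ∀ z, τ • z = (starRingEnd ℂ) z + π + 2 * I * δ)
    {r : ℝ} (hr : r ∈ Ioo (0 : ℝ) 1) :
    2 * π * lSigma g ≤
      ∫ s in (0 : ℝ)..π, mean q (artanh (r * Real.cos s) + δ) / √(1 - (r * Real.cos s) ^ 2) := by
  have hτ' : IsAffineDeck τ := by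
    rcases hτ with rfl | rfl
    · exact isAffineDeck_σ β
    · exact (isAffineDeck_t β).mul (isAffineDeck_σ β)
  have hc := h.continuous
  have hart := continuous_artanh_mul_cos hr
  have hr2 : 0 < 1 - r ^ 2 := by nlinarith [hr.1, hr.2]
  have hlong : Continuous (longitude √(1 - r ^ 2)) := continuous_iff_continuousAt.2 fun s =>
    (hasDerivAt_longitude (sqrt_pos.2 hr2) s).continuousAt
  have hne : ∀ s, (1 - (r * Real.cos s) ^ 2) ≠ 0 := fun s =>
    (one_sub_sq_pos (mul_cos_mem_Ioo hr s)).ne'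
  have hne' : ∀ s, √(1 - (r * Real.cos s) ^ 2) ≠ 0 := fun s =>
    (sqrt_pos.2 (one_sub_sq_pos (mul_cos_mem_Ioo hr s))).ne'
  have hcirc : ∀ x₀ : ℝ, lSigma g ≤ ∫ s in (0 : ℝ)..π,
      q (x₀ + longitude √(1 - r ^ 2) s + ((artanh (r * Real.cos s) + δ : ℝ) : ℂ) * I) *
        (1 / √(1 - (r * Real.cos s) ^ 2)) := by
    intro x₀
    have := h.leastLength_le hτ hτ' pi_pos (hasDerivAt_halfCircle hr x₀ δ)
      (by fun_prop (disch := exact hne _)) (by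
        rw [hτδ]
        simp only [longitude_zero, longitude_pi, Real.cos_pi, Real.cos_zero, mul_neg, mul_one,
          artanh_neg_eq, map_add, map_mul, conj_ofReal, conj_I]
        push_cast
        ring)
    simpa only [norm_deriv_halfCircle hr, lSigma] using this
  have hF : Continuous (Function.uncurry fun x₀ s : ℝ =>
      q (x₀ + longitude √(1 - r ^ 2) s + ((artanh (r * Real.cos s) + δ : ℝ) : ℂ) * I) *
        (1 / √(1 - (r * Real.cos s) ^ 2))) := by
    have hart' : Continuous fun p : ℝ × ℝ => artanh (r * Real.cos p.2) :=
      hart.comp continuous_snd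
    refine Continuous.mul (by fun_prop) (Continuous.div (by fun_prop) (by fun_prop) fun p => ?_)
    exact hne' p.2
  have hpi : -π ≤ π := by linarith [pi_pos]
  have h1 : ∫ _ in (-π)..π, lSigma g ≤ ∫ x₀ in (-π)..π, ∫ s in (0 : ℝ)..π,
      q (x₀ + longitude √(1 - r ^ 2) s + ((artanh (r * Real.cos s) + δ : ℝ) : ℂ) * I) *
        (1 / √(1 - (r * Real.cos s) ^ 2)) := by
    refine intervalIntegral.integral_mono_on hpi (by simp) ?_ fun x _ => hcirc x
    refine Continuous.intervalIntegrable ?_ _ _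
    exact intervalIntegral.continuous_parametric_intervalIntegral_of_continuous' hF _ _
  rw [intervalIntegral_swap hF hpi pi_pos.le] at h1
  simp only [intervalIntegral.integral_const, smul_eq_mul, intervalIntegral.integral_mul_const,
    h.mean_shift] at h1
  calc _ = _ := by ring
    _ ≤ _ := h1
    _ = _ := by simp only [mul_one_div]

/-- The averages of the conformal factor over opposite parallels, summed along a great circle,
dominate the least length of the glide reflections. -/
theorem IsConformalFactor.four_pi_mul_lSigma_le {r : ℝ} (hr : r ∈ Ioo (0 : ℝ) 1) :
    4 * π * lSigma g ≤ ∫ s in (0 : ℝ)..π, (mean q (artanh (r * Real.cos s)) +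
      mean q (artanh (r * Real.cos s) + β)) / √(1 - (r * Real.cos s) ^ 2) := by
  have h1 := h.two_pi_mul_lSigma_le_of_mem (τ := σ β) (by simp) (δ := 0)
    (fun z => by simp [σ_smul]) hr
  have h2 := h.two_pi_mul_lSigma_le_of_mem (τ := t β * σ β) (by simp) (δ := β)
    (fun z => by simp [t_mul_σ_smul]) hr
  have hne' : ∀ s, √(1 - (r * Real.cos s) ^ 2) ≠ 0 := fun s =>
    (sqrt_pos.2 (one_sub_sq_pos (mul_cos_mem_Ioo hr s))).ne'
  have hm := continuous_mean h.continuous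
  have hart := continuous_artanh_mul_cos hr
  simp only [add_zero] at h1
  simp only [add_div]
  rw [intervalIntegral.integral_add]
  · linarith
  · exact Continuous.intervalIntegrable (by fun_prop (disch := exact hne' _)) _ _
  · exact Continuous.intervalIntegrable (by fun_prop (disch := exact hne' _)) _ _

end Factor

end Averages

/-! ### The weighted systolic inequality. -/

section SystolicInequality

open MeasureTheory Set Complex

theorem sq_integral_mul_le {f g : ℝ → ℝ} (hf : Continuous f) (hg : Continuous g) {a b : ℝ}
    (hab : a ≤ b) :
    (∫ x in a..b, f x * g x) ^ 2 ≤ (∫ x in a..b, f x ^ 2) * ∫ x in a..b, g x ^ 2 := by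
  have hq : ∀ t : ℝ, 0 ≤ (∫ x in a..b, g x ^ 2) * (t * t) + 2 * (∫ x in a..b, f x * g x) * t +
      ∫ x in a..b, f x ^ 2 := by
    intro t
    have h1 : 0 ≤ ∫ x in a..b, (f x + t * g x) ^ 2 :=
      intervalIntegral.integral_nonneg hab fun x _ => sq_nonneg _
    have h2 : ∫ x in a..b, (f x + t * g x) ^ 2 = ∫ x in a..b,
        (t * t) * g x ^ 2 + (2 * t) * (f x * g x) + f x ^ 2 := by
      congr 1
      ext x
      ring
    rw [h2, intervalIntegral.integral_add (Continuous.intervalIntegrable (by fun_prop) _ _)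
        (Continuous.intervalIntegrable (by fun_prop) _ _),
      intervalIntegral.integral_add (Continuous.intervalIntegrable (by fun_prop) _ _)
        (Continuous.intervalIntegrable (by fun_prop) _ _),
      intervalIntegral.integral_const_mul, intervalIntegral.integral_const_mul] at h1
    linarith
  have := discrim_le_zero hq
  rw [discrim] at this
  nlinarith

/-- After folding to $[0,\beta]$, the half $[\beta/2,\beta]$ is reflected by $y\mapsto\beta-y$, and
$f(\beta-y)=f(y+\beta)$. -/
theorem integral_even_periodic {f : ℝ → ℝ} (hf : Continuous f) {β : ℝ} (he : ∀ y, f (-y) = f y)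
    (hp : ∀ y, f (y + 2 * β) = f y) :
    ∫ y in (-β)..β, f y = 2 * ∫ y in (0 : ℝ)..β / 2, (f y + f (y + β)) := by
  have hi : ∀ a b, IntervalIntegrable f volume a b := hf.intervalIntegrable
  have h1 := intervalIntegral.integral_comp_neg (a := 0) (b := β) f
  simp only [he, neg_zero] at h1
  have h2 := intervalIntegral.integral_comp_sub_left (a := 0) (b := β / 2) f β
  have h3 : ∀ y, f (β - y) = f (y + β) := fun y => by
    rw [← he, ← hp]
    ring_nf
  simp only [h3, sub_zero] at h2
  rw [intervalIntegral.integral_add (hi _ _)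
    (Continuous.intervalIntegrable (by fun_prop) _ _), h2, sub_half,
    intervalIntegral.integral_add_adjacent_intervals (hi _ _) (hi _ _),
    ← intervalIntegral.integral_add_adjacent_intervals (hi (-β) 0) (hi 0 β), ← h1]
  ring

theorem leastLength_nonneg {β : ℝ} (g : RiemannianMetric β) (T : Set (deckGroup β)) :
    0 ≤ leastLength g T := by
  refine Real.sInf_nonneg ?_
  rintro L ⟨γ, c, -, -, rfl⟩
  exact length_nonneg g c

section Factor

variable {β : ℝ} {g : RiemannianMetric β} {q : ℂ → ℝ} (h : IsConformalFactor g q)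
include h

theorem IsConformalFactor.vol_eq (hβ : 0 < β) :
    vol g = ∫ x in (-(π / 2))..(π / 2), ∫ y in (-β)..β, q (x + y * I) ^ 2 := by
  have hc := h.continuous
  have hpi : -(π / 2) ≤ π / 2 := by linarith [pi_pos]
  have hint : ∀ z, √(g.inner z 1 1 * g.inner z I I - g.inner z 1 I ^ 2) = q z ^ 2 := by
    intro z
    simp only [h.inner_eq]
    simp only [one_re, one_im, I_re, I_im]
    norm_num
    rw [← pow_two, sqrt_sq (sq_nonneg _)]
  rw [vol]
  simp only [hint]
  rw [← Complex.volume_preserving_equiv_real_prod.symm.setIntegral_preimage_emb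
    Complex.measurableEquivRealProd.symm.measurableEmbedding]
  have hpre : Complex.measurableEquivRealProd.symm ⁻¹' (Icc (-(π / 2)) (π / 2) ×ℂ Icc (-β) β) =
      Icc (-(π / 2)) (π / 2) ×ˢ Icc (-β) β := by
    ext p
    rw [mem_preimage, Complex.mem_reProdIm, mem_prod]
    rfl
  rw [hpre, Measure.volume_eq_prod, setIntegral_prod, intervalIntegral.integral_of_le hpi,
    integral_Icc_eq_integral_Ioc]
  · congr 1
    ext x
    rw [intervalIntegral.integral_of_le (by linarith), integral_Icc_eq_integral_Ioc]
    congr 1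
    ext y
    rw [← Complex.mk_eq_add_mul_I]
    rfl
  · refine ContinuousOn.integrableOn_compact (isCompact_Icc.prod isCompact_Icc) ?_
    have : Continuous (Complex.measurableEquivRealProd.symm) :=
      Complex.equivRealProdCLM.symm.continuous
    exact ((hc.comp this).pow 2).continuousOn

/-- The glide reflection carries the column over $x$ to the reversed column over $x+\pi$, so column
integrals have period $\pi$ and the width $2\pi$ counts the area twice. -/
theorem IsConformalFactor.two_mul_vol (hβ : 0 < β) :
    2 * vol g = ∫ x in (-π)..π, ∫ y in (-β)..β, q (x + y * I) ^ 2 := by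
  have hc := h.continuous
  set C : ℝ → ℝ := fun x => ∫ y in (-β)..β, q (x + y * I) ^ 2 with hC
  have hCc : Continuous C :=
    intervalIntegral.continuous_parametric_intervalIntegral_of_continuous'
      (f := fun x y : ℝ => q (x + y * I) ^ 2) (by fun_prop) _ _
  have hper : Function.Periodic C π := by
    intro x
    have h1 := intervalIntegral.integral_comp_neg (a := -β) (b := β)
      (fun y : ℝ => q ((x + π : ℝ) + y * I) ^ 2)
    rw [neg_neg] at h1
    simp only [hC, ← h1]
    refine intervalIntegral.integral_congr fun y _ => ?_
    have := h.conj_add_pi (x + y * I)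
    simp only [map_add, map_mul, conj_ofReal, conj_I] at this
    simp only [← this]
    push_cast
    ring_nf
  have hi : ∀ a b, IntervalIntegrable C volume a b := hCc.intervalIntegrable
  have h1 := hper.intervalIntegral_add_eq (-(π / 2)) (-π)
  have h2 := hper.intervalIntegral_add_eq (-(π / 2)) 0
  rw [show -(π / 2) + π = π / 2 by ring, neg_add_cancel] at h1
  rw [show -(π / 2) + π = π / 2 by ring, zero_add] at h2
  rw [h.vol_eq hβ, ← intervalIntegral.integral_add_adjacent_intervals (hi (-π) 0) (hi 0 π)]
  linarith

/-- Cauchy–Schwarz on each parallel, with equality when $q$ depends on $y$ only. -/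
theorem IsConformalFactor.integral_mean_sq_le (hβ : 0 < β) :
    ∫ y in (-β)..β, mean q y ^ 2 ≤ 4 * π * vol g := by
  have hc := h.continuous
  have hpi : -π ≤ π := by linarith [pi_pos]
  have hle : ∀ y, mean q y ^ 2 ≤ 2 * π * ∫ x in (-π)..π, q (x + y * I) ^ 2 := by
    intro y
    have := sq_integral_mul_le (f := fun x : ℝ => q (x + y * I)) (g := fun _ => 1) (by fun_prop)
      continuous_const hpi
    simp only [mul_one, one_pow, intervalIntegral.integral_const, smul_eq_mul] at this
    rw [mean]
    linarith
  have hcont : Continuous fun y : ℝ => ∫ x in (-π)..π, q (x + y * I) ^ 2 :=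
    intervalIntegral.continuous_parametric_intervalIntegral_of_continuous'
      (f := fun y x : ℝ => q (x + y * I) ^ 2) (by fun_prop) _ _
  have hm := continuous_mean hc
  calc ∫ y in (-β)..β, mean q y ^ 2
      ≤ ∫ y in (-β)..β, 2 * π * ∫ x in (-π)..π, q (x + y * I) ^ 2 :=
        intervalIntegral.integral_mono_on (by linarith)
          (Continuous.intervalIntegrable (by fun_prop) _ _)
          (Continuous.intervalIntegrable (by fun_prop) _ _) fun y _ => hle y
    _ = 4 * π * vol g := by
      rw [intervalIntegral.integral_const_mul, ← intervalIntegral_swap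
        (F := fun x y : ℝ => q (x + y * I) ^ 2) (by fun_prop) hpi (by linarith),
        ← h.two_mul_vol hβ]
      ring

/-- The systolic inequality with weights, obtained by mixing closed curves of the three classes. -/
theorem IsConformalFactor.weighted_inequality (hβ : 0 < β) {R a d : ℝ} (hR0 : 0 < R)
    (hR1 : R < 1) (ha0 : 0 ≤ a) (ha1 : a ≤ 1) (hd : 0 ≤ d) (hβd : β / 2 = artanh R + d) :
    4 * (R - a * √(1 - R ^ 2) * arcsin R) * lSigma g + 2 * (1 - a) * √(1 - R ^ 2) * d * lHor g +
      π * (a * √(1 - R ^ 2)) * lVert g ≤ √(4 * π * vol g * (R + (1 - R ^ 2) * d)) := by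
  set A := a * √(1 - R ^ 2) with hA
  set k := √(1 - R ^ 2) with hk
  have hk2 : 0 < 1 - R ^ 2 := by nlinarith
  have hk0 : 0 < k := sqrt_pos.2 hk2
  have hksq : k ^ 2 = 1 - R ^ 2 := sq_sqrt hk2.le
  have hRm : R ∈ Ioo (-1 : ℝ) 1 := ⟨by linarith, hR1⟩
  set Y := artanh R with hY
  have hY0 : 0 ≤ Y := artanh_nonneg hR0.le
  have hYβ : Y ≤ β / 2 := by linarith
  have hkY : 1 / Real.cosh Y = k := by rw [hY, cosh_artanh hRm, one_div_one_div]
  have hm := continuous_mean h.continuous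
  set Ψ : ℝ → ℝ := fun y => mean q y + mean q (y + β) with hΨ
  have hΨc : Continuous Ψ := by fun_prop
  have hΨe : ∀ y, Ψ (-y) = Ψ y := by
    intro y
    have h1 := h.mean_add_period (-(y + β))
    have h2 := h.mean_neg (y + β)
    rw [show -(y + β) + 2 * β = -y + β by ring] at h1
    simp only [hΨ, h.mean_neg y, h1, h2]
  have hΨ0 : ∀ y, 0 ≤ Ψ y := fun y => add_nonneg (h.mean_pos y).le (h.mean_pos _).le
  have hsigma : 4 * (R - A * arcsin R) * lSigma g ≤
      ∫ y in (0 : ℝ)..Y, Ψ y * (1 / Real.cosh y - A) := by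
    have hs : 0 ≤ lSigma g := leastLength_nonneg _ _
    have := zone_inequality hΨc hΨ0 hΨe (L := 4 * π * lSigma g) (by positivity)
      (fun r hr => h.four_pi_mul_lSigma_le hr) hR0 hR1 ha0 ha1
    refine le_of_mul_le_mul_left ?_ pi_pos
    linarith
  have hhor : 2 * d * lHor g ≤ ∫ y in Y..β / 2, Ψ y := by
    have : ∫ _ in Y..β / 2, 2 * lHor g ≤ ∫ y in Y..β / 2, Ψ y := by
      refine intervalIntegral.integral_mono_on hYβ (by simp) (hΨc.intervalIntegrable _ _)
        fun y _ => ?_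
      have h1 := h.lHor_le y
      have h2 := h.lHor_le (y + β)
      simp only [hΨ]
      linarith
    rw [intervalIntegral.integral_const, smul_eq_mul, hβd] at this
    rw [hβd]
    linarith
  have hvert : π * lVert g ≤ ∫ y in (0 : ℝ)..β / 2, Ψ y := by
    have h1 := h.two_pi_mul_lVert_le hβ
    rw [integral_even_periodic hm h.mean_neg h.mean_add_period] at h1
    linarith
  -- By $(s+t)^2\le2(s^2+t^2)$ for the averages over opposite parallels; the 2 is that of the
  -- folding.
  have hsq : ∫ y in (0 : ℝ)..β / 2, Ψ y ^ 2 ≤ 4 * π * vol g := by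
    refine le_trans ?_ (h.integral_mean_sq_le hβ)
    rw [integral_even_periodic (f := fun y => mean q y ^ 2) (by fun_prop)
      (fun y => by rw [h.mean_neg]) (fun y => by rw [h.mean_add_period]),
      ← intervalIntegral.integral_const_mul]
    refine intervalIntegral.integral_mono_on (by linarith)
      (Continuous.intervalIntegrable (by fun_prop) _ _)
      (Continuous.intervalIntegrable (by fun_prop) _ _) fun y _ => ?_
    simp only [hΨ]
    nlinarith [sq_nonneg (mean q y - mean q (y + β))]
  -- The extremal density: spherical up to $Y$, then constant, equal to $k$.
  set D : ℝ → ℝ := fun y => 1 / Real.cosh (min y Y) with hD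
  have hch : Continuous fun y => 1 / Real.cosh y :=
    continuous_const.div Real.continuous_cosh fun y => (Real.cosh_pos y).ne'
  have hDc : Continuous D := hch.comp (continuous_id.min continuous_const)
  have hsplit : ∀ f : ℝ → ℝ, Continuous f → ∀ F : ℝ → ℝ → ℝ, Continuous (Function.uncurry F) →
      ∫ y in (0 : ℝ)..β / 2, F (f y) (D y) =
        (∫ y in (0 : ℝ)..Y, F (f y) (1 / Real.cosh y)) + ∫ y in Y..β / 2, F (f y) k := by
    intro f hf F hF
    have hc : Continuous fun y => F (f y) (D y) := hF.comp (hf.prodMk hDc)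
    rw [← intervalIntegral.integral_add_adjacent_intervals (b := Y) (hc.intervalIntegrable _ _)
      (hc.intervalIntegrable _ _)]
    congr 1
    · refine intervalIntegral.integral_congr fun y hy => ?_
      rw [uIcc_of_le hY0] at hy
      simp only [hD, min_eq_left hy.2]
    · refine intervalIntegral.integral_congr fun y hy => ?_
      rw [uIcc_of_le hYβ] at hy
      simp only [hD, min_eq_right hy.1, hkY]
  have hDsq : ∫ y in (0 : ℝ)..β / 2, D y ^ 2 = R + (1 - R ^ 2) * d := by
    rw [hsplit (fun _ => 0) continuous_const (fun _ y => y ^ 2) (by fun_prop),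
      intervalIntegral.integral_const, smul_eq_mul, hksq, hβd]
    have hder : ∀ y ∈ uIcc 0 Y, HasDerivAt Real.tanh ((1 / Real.cosh y) ^ 2) y := by
      intro y _
      have h1 := (Real.hasDerivAt_sinh y).div (Real.hasDerivAt_cosh y) (Real.cosh_pos y).ne'
      have h2 : Real.tanh = Real.sinh / Real.cosh := funext Real.tanh_eq_sinh_div_cosh
      rw [h2]
      convert! h1 using 1
      rw [one_div, inv_pow, ← one_div]
      congr 1
      linear_combination -Real.cosh_sq_sub_sinh_sq y
    rw [intervalIntegral.integral_eq_sub_of_hasDerivAt hder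
      (Continuous.intervalIntegrable (by fun_prop) _ _), Real.tanh_zero, hY, tanh_artanh hRm]
    ring
  -- The three densities add up to $D$: $(1/\cosh y-A)+A$ below $Y$, and $(1-a)k+A=k$ above.
  have hΨD : 4 * (R - A * arcsin R) * lSigma g + 2 * (1 - a) * k * d * lHor g +
      π * A * lVert g ≤ ∫ y in (0 : ℝ)..β / 2, Ψ y * D y := by
    rw [hsplit Ψ hΨc (fun x y => x * y) (by fun_prop), intervalIntegral.integral_mul_const]
    have h1 : ∫ y in (0 : ℝ)..Y, Ψ y * (1 / Real.cosh y - A) =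
        (∫ y in (0 : ℝ)..Y, Ψ y * (1 / Real.cosh y)) - A * ∫ y in (0 : ℝ)..Y, Ψ y := by
      simp only [mul_sub]
      rw [intervalIntegral.integral_sub (Continuous.intervalIntegrable (by fun_prop) _ _)
        (Continuous.intervalIntegrable (by fun_prop) _ _), intervalIntegral.integral_mul_const]
      ring
    have h2 := intervalIntegral.integral_add_adjacent_intervals
      (hΨc.intervalIntegrable (μ := volume) 0 Y) (hΨc.intervalIntegrable Y (β / 2))
    have hA0 : 0 ≤ A := by positivity
    have hkA : 0 ≤ (1 - a) * k := mul_nonneg (by linarith) hk0.le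
    have h3 := mul_le_mul_of_nonneg_left hhor hkA
    have h4 := mul_le_mul_of_nonneg_left hvert hA0
    have h5 : (1 - a) * k * ∫ y in Y..β / 2, Ψ y = k * (∫ y in Y..β / 2, Ψ y) -
      A * ∫ y in Y..β / 2, Ψ y := by rw [hA]; ring
    rw [← h2] at h4
    linarith
  refine hΨD.trans (le_sqrt_of_sq_le ?_)
  refine (sq_integral_mul_le hΨc hDc (by linarith)).trans ?_
  rw [hDsq]
  have : 0 ≤ R + (1 - R ^ 2) * d := by positivity
  gcongr

end Factor

end SystolicInequality

/-! ### The plane as a covering of the Klein bottle; endpoints of lifts. -/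

section Covering

open Set Complex

/-- Normal form of the group elements; the parity of $m$ tells whether orientation is preserved. -/
theorem deckGroup_smul_eq {β : ℝ} (τ : deckGroup β) : ∃ m n : ℤ,
    (Even m ∧ ∀ z : ℂ, τ • z = z + m * π + 2 * I * β * n) ∨
    (Odd m ∧ ∀ z : ℂ, τ • z = (starRingEnd ℂ) z + m * π + 2 * I * β * n) := by
  obtain ⟨τ, hτ⟩ := τ
  change ∃ m n : ℤ, (Even m ∧ ∀ z : ℂ, τ z = _) ∨ (Odd m ∧ ∀ z : ℂ, τ z = _)
  induction hτ using Subgroup.closure_induction with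
  | mem x hx =>
    rcases hx with rfl | rfl
    · exact ⟨1, 0, .inr ⟨odd_one, fun z => by simp [glide]⟩⟩
    · exact ⟨0, 1, .inl ⟨Even.zero, fun z => by simp [vert]⟩⟩
  | one => exact ⟨0, 0, .inl ⟨Even.zero, fun z => by simp⟩⟩
  | mul x y _ _ hx hy =>
    obtain ⟨m, n, hx⟩ := hx
    obtain ⟨m', n', hy⟩ := hy
    rcases hx with ⟨hm, hx⟩ | ⟨hm, hx⟩ <;> rcases hy with ⟨hm', hy⟩ | ⟨hm', hy⟩
    · refine ⟨m + m', n + n', .inl ⟨hm.add hm', fun z => ?_⟩⟩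
      rw [Equiv.Perm.mul_apply, hx, hy]
      push_cast
      ring
    · refine ⟨m + m', n + n', .inr ⟨hm.add_odd hm', fun z => ?_⟩⟩
      rw [Equiv.Perm.mul_apply, hx, hy]
      push_cast
      ring
    · refine ⟨m + m', n - n', .inr ⟨hm.add_even hm', fun z => ?_⟩⟩
      rw [Equiv.Perm.mul_apply, hx, hy]
      simp [Complex.conj_ofNat]
      ring
    · refine ⟨m + m', n - n', .inl ⟨hm.add_odd hm', fun z => ?_⟩⟩
      rw [Equiv.Perm.mul_apply, hx, hy]
      simp [Complex.conj_ofNat]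
      ring
  | inv x _ hx =>
    obtain ⟨m, n, hx⟩ := hx
    rcases hx with ⟨hm, hx⟩ | ⟨hm, hx⟩
    · refine ⟨-m, -n, .inl ⟨hm.neg, fun z => ?_⟩⟩
      rw [Equiv.Perm.inv_eq_iff_eq, hx]
      push_cast
      ring
    · refine ⟨-m, n, .inr ⟨hm.neg, fun z => ?_⟩⟩
      rw [Equiv.Perm.inv_eq_iff_eq, hx]
      simp [Complex.conj_ofNat]
      ring

theorem continuous_deck_smul {β : ℝ} (τ : deckGroup β) : Continuous fun z : ℂ => τ • z := by
  obtain ⟨m, n, ⟨-, h⟩ | ⟨-, h⟩⟩ := deckGroup_smul_eq τ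
  · rw [funext h]
    fun_prop
  · rw [funext h]
    have := continuous_conj
    fun_prop

/-- An orientation-reversing element shifts the real part by an odd multiple of $\pi$; a nontrivial
translation moves points by at least $2\pi$ horizontally or $2\beta$ vertically. This uniform
displacement makes the action free and the projection a covering. -/
theorem deck_eq_one_of_norm_lt {β : ℝ} (hβ : 0 < β) {τ : deckGroup β} {z : ℂ}
    (h : ‖τ • z - z‖ < min π (2 * β)) : τ = 1 := by
  have hre := (abs_re_le_norm (τ • z - z)).trans_lt (h.trans_le (min_le_left _ _))
  have him := (abs_im_le_norm (τ • z - z)).trans_lt (h.trans_le (min_le_right _ _))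
  have key : ∀ m : ℤ, |(m : ℝ) * π| < π → m = 0 := by
    intro m hm
    rw [abs_mul, abs_of_pos pi_pos] at hm
    have : |(m : ℝ)| < 1 := by nlinarith [pi_pos]
    exact Int.abs_lt_one_iff.1 (by exact_mod_cast this)
  obtain ⟨m, n, ⟨hm, hz⟩ | ⟨hm, hz⟩⟩ := deckGroup_smul_eq τ
  · have hm0 : m = 0 := key m (by simpa [hz] using hre)
    have hn0 : n = 0 := by
      have h1 : |2 * β * (n : ℝ)| < 2 * β := by simpa [hz] using him
      rw [abs_mul, abs_of_pos (by positivity : 0 < 2 * β)] at h1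
      have : |(n : ℝ)| < 1 := by nlinarith
      exact Int.abs_lt_one_iff.1 (by exact_mod_cast this)
    ext w
    change τ • w = w
    simp [hz, hm0, hn0]
  · have hm0 : m = 0 := key m (by simpa [hz] using hre)
    subst hm0
    exact absurd hm (by decide)

theorem proj_eq_iff {β : ℝ} {z w : ℂ} :
    proj β z = proj β w ↔ z ∈ MulAction.orbit (deckGroup β) w :=
  Quotient.eq''

theorem isQuotientCoveringMap_proj {β : ℝ} (hβ : 0 < β) :
    IsQuotientCoveringMap (proj β) (deckGroup β) where
  __ := (isQuotientMap_quotient_mk' : Topology.IsQuotientMap (proj β))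
  continuous_const_smul := continuous_deck_smul
  apply_eq_iff_mem_orbit := proj_eq_iff
  disjoint e := by
    have h0 : 0 < min π (2 * β) := lt_min pi_pos (by positivity)
    refine ⟨Metric.ball e (min π (2 * β) / 2), Metric.ball_mem_nhds _ (by positivity), ?_⟩
    rintro τ ⟨_, ⟨z, hz, rfl⟩, hz'⟩
    refine deck_eq_one_of_norm_lt hβ (z := z) ?_
    rw [← dist_eq_norm]
    have := dist_triangle_right (τ • z) z e
    rw [Metric.mem_ball] at hz hz'
    simp only at hz'
    linarith

/-- A path that covers a loop in the free homotopy class of a deck transformation is closed by a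
conjugate of this transformation. -/
theorem exists_conjugate_of_homotopic {β : ℝ} (hβ : 0 < β) {τ : deckGroup β}
    {γ : C(UnitAddCircle, KleinBottle β)} (hγ : γ.Homotopic (deckLoop β τ)) {c : ℝ → ℂ}
    (hc : IsRectifiableLift γ c) : ∃ ρ : deckGroup β, ∃ w : ℂ, c 0 = ρ • w ∧ c 1 = ρ • τ • w := by
  obtain ⟨F⟩ := hγ
  obtain ⟨⟨C, hC⟩, hlift⟩ := hc
  have hq := isQuotientCoveringMap_proj hβ
  have hcov := hq.isCoveringMap
  have hcancel := hq.isCancelSMul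
  let H : C(unitInterval × unitInterval, KleinBottle β) :=
    ⟨fun p => F (p.1, ((p.2 : ℝ) : UnitAddCircle)), by fun_prop⟩
  let f : C(unitInterval, ℂ) := ⟨fun s => c s, hC.continuousOn.comp_continuous
    continuous_subtype_val fun s => s.2⟩
  have hH0 : ∀ s, H (0, s) = proj β (f s) := fun s => by
    simp only [H, f, ContinuousMap.coe_mk]
    rw [F.apply_zero, hlift s s.2]
  let K := hcov.liftHomotopy H f hH0
  have hK : ∀ p, proj β (K p) = H p := fun p => congrFun (hcov.liftHomotopy_lifts H f hH0) p
  have hK0 : ∀ s, K (0, s) = c s := fun s => hcov.liftHomotopy_zero H f hH0 s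
  have hends : ∀ r, H (r, 1) = H (r, 0) := fun r => by
    simp only [H, ContinuousMap.coe_mk, Set.Icc.coe_one, Set.Icc.coe_zero,
      AddCircle.coe_period, QuotientAddGroup.mk_zero]
  obtain ⟨τ', hτ'⟩ : c 1 ∈ MulAction.orbit (deckGroup β) (c 0) := by
    rw [← proj_eq_iff]
    have h1 := hK (0, 1)
    have h0 := hK (0, 0)
    rw [hK0] at h1 h0
    exact h1.trans ((hends 0).trans h0.symm)
  -- The two vertical sides of the lifted square cover the same path, so uniqueness of lifts makes
  -- one a fixed translate of the other. The same argument identifies the top side.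
  have hside : (fun r => K (r, 1)) = fun r => τ' • K (r, 0) := by
    refine hcov.eq_of_comp_eq (by fun_prop)
      ((continuous_deck_smul τ').comp (g := fun z : ℂ => τ' • z) (by fun_prop)) ?_ 0 ?_
    · ext r
      simp only [Function.comp, proj_smul, hK, hends]
    · simp only [hK0]
      exact hτ'.symm
  have hH1 : ∀ s : unitInterval, H (1, s) = proj β (((s : ℝ) : ℂ) * (τ • (0 : ℂ))) := fun s => by
    simp only [H, ContinuousMap.coe_mk]
    rw [F.apply_one, deckLoop_coe τ s.2]
  obtain ⟨ρ, hρ⟩ : K (1, 0) ∈ MulAction.orbit (deckGroup β) (0 : ℂ) := by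
    rw [← proj_eq_iff, hK, hH1]
    simp
  have htop : (fun s => K (1, s)) =
      fun s : unitInterval => ρ • (((s : ℝ) : ℂ) * (τ • (0 : ℂ))) := by
    refine hcov.eq_of_comp_eq (by fun_prop)
      ((continuous_deck_smul ρ).comp (g := fun z : ℂ => ρ • z) (by fun_prop)) ?_ 0 ?_
    · ext s
      simp only [Function.comp, proj_smul, hK, hH1]
    · simp only [Set.Icc.coe_zero, ofReal_zero, zero_mul]
      exact hρ.symm
  -- Comparison at the corner $(1,1)$; as the action is free, the group elements themselves agree.
  have hcorner : (τ' * ρ) • (0 : ℂ) = (ρ * τ) • (0 : ℂ) := by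
    have h1 := congrFun hside 1
    have h2 := congrFun htop 1
    simp only [Set.Icc.coe_one, ofReal_one, one_mul] at h1 h2
    rw [mul_smul, mul_smul, ← h2, h1]
    exact congrArg _ hρ
  have hconj : τ' * ρ = ρ * τ := IsCancelSMul.right_cancel _ _ _ hcorner
  refine ⟨ρ, ρ⁻¹ • c 0, (smul_inv_smul ρ _).symm, ?_⟩
  rw [← mul_smul, ← mul_smul, ← hconj, mul_inv_cancel_right]
  exact hτ'.symm

/-- Conjugation by an orientation-reversing element inverts $t$: hence the two signs. -/
theorem end_of_homotopic_t {β : ℝ} (hβ : 0 < β) {γ : C(UnitAddCircle, KleinBottle β)}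
    (hγ : γ.Homotopic (deckLoop β (t β))) {c : ℝ → ℂ} (hc : IsRectifiableLift γ c) :
    (c 1).im = (c 0).im + 2 * β ∨ (c 1).im = (c 0).im - 2 * β := by
  obtain ⟨ρ, w, h0, h1⟩ := exists_conjugate_of_homotopic hβ hγ hc
  obtain ⟨m, n, ⟨-, h⟩ | ⟨-, h⟩⟩ := deckGroup_smul_eq ρ
  · left
    simp [h0, h1, h, t_smul]
    ring
  · right
    simp [h0, h1, h, t_smul]
    ring

/-- The element $\sigma^2$ is central, so only one sign occurs. -/
theorem end_of_homotopic_σ_sq {β : ℝ} (hβ : 0 < β) {γ : C(UnitAddCircle, KleinBottle β)}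
    (hγ : γ.Homotopic (deckLoop β (σ β ^ 2))) {c : ℝ → ℂ} (hc : IsRectifiableLift γ c) :
    (c 1).re = (c 0).re + 2 * π := by
  obtain ⟨ρ, w, h0, h1⟩ := exists_conjugate_of_homotopic hβ hγ hc
  obtain ⟨m, n, ⟨-, h⟩ | ⟨-, h⟩⟩ := deckGroup_smul_eq ρ <;>
  · simp [h0, h1, h, σ_sq_smul]
    ring

theorem end_of_homotopic_glide {β : ℝ} (hβ : 0 < β) {γ : C(UnitAddCircle, KleinBottle β)}
    (hγ : ∃ τ ∈ ({σ β, t β * σ β} : Set (deckGroup β)), γ.Homotopic (deckLoop β τ)) {c : ℝ → ℂ}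
    (hc : IsRectifiableLift γ c) :
    (c 1).re = (c 0).re + π ∧ ∃ n : ℤ, (c 1).im = -(c 0).im + 2 * β * n := by
  obtain ⟨τ, hτ, hγ⟩ := hγ
  obtain ⟨ρ, w, h0, h1⟩ := exists_conjugate_of_homotopic hβ hγ hc
  have hτ' : ∃ j : ℤ, ∀ z, τ • z = (starRingEnd ℂ) z + π + 2 * I * β * j := by
    rcases hτ with rfl | rfl
    · exact ⟨0, fun z => by simp [σ_smul]⟩
    · exact ⟨1, fun z => by simp [t_mul_σ_smul]⟩
  obtain ⟨j, hj⟩ := hτ'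
  obtain ⟨m, n, ⟨-, h⟩ | ⟨-, h⟩⟩ := deckGroup_smul_eq ρ
  · refine ⟨?_, 2 * n + j, ?_⟩ <;>
    · simp [h0, h1, h, hj]
      ring
  · refine ⟨?_, 2 * n - j, ?_⟩ <;>
    · simp [h0, h1, h, hj]
      ring

end Covering

/-! ### The flat-spherical metric: coordinates, conformal factor, area. -/

section Profile

open MeasureTheory Set

theorem profile_eq_norm {ω b : ℝ} (v : ℝ) :
    profile ω b v = cos (min ‖(v : AddCircle (2 * b))‖ ω) := by
  rw [profile, AddCircle.norm_eq, mul_comm (2 * b), div_eq_inv_mul]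

theorem continuous_profile (ω b : ℝ) : Continuous (profile ω b) := by
  rw [funext profile_eq_norm]
  have : Continuous fun v : ℝ => (v : AddCircle (2 * b)) := AddCircle.continuous_mk' _
  fun_prop

theorem profile_neg (ω b v : ℝ) : profile ω b (-v) = profile ω b v := by
  rw [profile_eq_norm, profile_eq_norm, AddCircle.coe_neg, norm_neg]

theorem profile_periodic (ω b : ℝ) : Function.Periodic (profile ω b) (2 * b) := fun v => by
  rw [profile_eq_norm, profile_eq_norm, AddCircle.coe_add_period]

theorem profile_of_mem_Icc {ω b v : ℝ} (hv : v ∈ Icc 0 b) :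
    profile ω b v = cos (min v ω) := by
  rcases hv.1.eq_or_lt with rfl | h0
  · simp [profile_eq_norm]
  have hb : 0 < b := h0.trans_le hv.2
  rw [profile_eq_norm, (AddCircle.norm_coe_eq_abs_iff (2 * b) (by positivity)).2, abs_of_pos h0]
  rw [abs_of_pos h0, abs_of_pos (by positivity)]
  linarith [hv.2]

theorem cos_le_profile {ω b : ℝ} (hω : ω ∈ Ioo 0 (π / 2)) (v : ℝ) : cos ω ≤ profile ω b v := by
  rw [profile_eq_norm]
  exact cos_le_cos_of_nonneg_of_le_pi (le_min (norm_nonneg _) hω.1.le)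
    (by linarith [hω.2, pi_pos]) (min_le_right _ _)

/-- The conformal factor dominates that of the round sphere, with the latitude truncated at the
pole; this is what gives `le_lSigma_flatSpherical`. -/
theorem cos_min_le_profile {ω b : ℝ} (hω : ω ∈ Ioo 0 (π / 2)) (v : ℝ) :
    cos (min |v| (π / 2)) ≤ profile ω b v := by
  rw [profile_eq_norm]
  refine cos_le_cos_of_nonneg_of_le_pi (le_min (norm_nonneg _) hω.1.le) ?_
    (min_le_min ?_ hω.2.le)
  · exact (min_le_right _ _).trans (by linarith [pi_pos])
  · exact QuotientAddGroup.norm_mk_le_norm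

theorem profile_le_one (ω b v : ℝ) : profile ω b v ≤ 1 := cos_le_one _

theorem cos_pos_of_mem {ω : ℝ} (hω : ω ∈ Ioo 0 (π / 2)) : 0 < cos ω :=
  cos_pos_of_mem_Ioo ⟨by linarith [hω.1, pi_pos], hω.2⟩

theorem profile_pos {ω b : ℝ} (hω : ω ∈ Ioo 0 (π / 2)) (v : ℝ) : 0 < profile ω b v :=
  (cos_pos_of_mem hω).trans_le (cos_le_profile hω v)

theorem continuous_one_div_profile {ω b : ℝ} (hω : ω ∈ Ioo 0 (π / 2)) :
    Continuous fun v => 1 / profile ω b v :=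
  continuous_const.div (continuous_profile ω b) fun v => (profile_pos hω v).ne'

/-- The conformal ordinate of a point of latitude `v`. -/
noncomputable def ordinate (ω b v : ℝ) : ℝ := ∫ s in (0 : ℝ)..v, 1 / profile ω b s

theorem hasDerivAt_ordinate {ω b : ℝ} (hω : ω ∈ Ioo 0 (π / 2)) (v : ℝ) :
    HasDerivAt (ordinate ω b) (1 / profile ω b v) v :=
  (continuous_one_div_profile hω).integral_hasStrictDerivAt 0 v |>.hasDerivAt

theorem ordinate_neg (ω b v : ℝ) : ordinate ω b (-v) = -ordinate ω b v := by
  have := intervalIntegral.integral_comp_neg (a := 0) (b := v) fun s => 1 / profile ω b s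
  simp only [profile_neg, neg_zero] at this
  rw [ordinate, ordinate, this, intervalIntegral.integral_symm]

theorem integral_even {f : ℝ → ℝ} (hf : Continuous f) (he : ∀ y, f (-y) = f y) (β : ℝ) :
    ∫ y in (-β)..β, f y = 2 * ∫ y in (0 : ℝ)..β, f y := by
  have h1 := intervalIntegral.integral_comp_neg (a := 0) (b := β) f
  simp only [he, neg_zero] at h1
  rw [← intervalIntegral.integral_add_adjacent_intervals (hf.intervalIntegrable (-β) 0)
    (hf.intervalIntegrable 0 β), ← h1, two_mul]

theorem ordinate_add_period {ω b : ℝ} (hω : ω ∈ Ioo 0 (π / 2)) (v : ℝ) :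
    ordinate ω b (v + 2 * b) = ordinate ω b v + 2 * ordinate ω b b := by
  have hc := continuous_one_div_profile (b := b) hω
  have hi : ∀ x y, IntervalIntegrable (fun s => 1 / profile ω b s) volume x y :=
    hc.intervalIntegrable
  have hp : Function.Periodic (fun s => 1 / profile ω b s) (2 * b) := fun s => by
    simp only [profile_periodic ω b s]
  have h1 := hp.intervalIntegral_add_eq v (-b)
  have h2 := integral_even hc (fun s => by simp only [profile_neg]) b
  rw [show -b + 2 * b = b by ring, h2] at h1
  simp only [ordinate]
  rw [← h1, intervalIntegral.integral_add_adjacent_intervals (hi _ _) (hi _ _)]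

theorem strictMono_ordinate {ω b : ℝ} (hω : ω ∈ Ioo 0 (π / 2)) : StrictMono (ordinate ω b) :=
  strictMono_of_hasDerivAt_pos (hasDerivAt_ordinate hω) fun v => by
    have := profile_pos (b := b) hω v
    positivity

theorem continuous_ordinate {ω b : ℝ} (hω : ω ∈ Ioo 0 (π / 2)) : Continuous (ordinate ω b) :=
  continuous_iff_continuousAt.2 fun v => (hasDerivAt_ordinate hω v).continuousAt

theorem le_ordinate {ω b : ℝ} (hω : ω ∈ Ioo 0 (π / 2)) {v : ℝ} (hv : 0 ≤ v) :
    v ≤ ordinate ω b v := by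
  have h1 : ∫ _ in (0 : ℝ)..v, (1 : ℝ) ≤ ordinate ω b v := by
    refine intervalIntegral.integral_mono_on hv (by simp)
      ((continuous_one_div_profile hω).intervalIntegrable _ _) fun s _ => ?_
    rw [le_div_iff₀ (profile_pos hω s), one_mul]
    exact profile_le_one ω b s
  simpa using h1

theorem surjective_ordinate {ω b : ℝ} (hω : ω ∈ Ioo 0 (π / 2)) :
    Function.Surjective (ordinate ω b) := by
  refine (continuous_ordinate hω).surjective ?_ ?_
  · refine Filter.tendsto_atTop_mono' _ ?_ Filter.tendsto_id
    filter_upwards [Filter.eventually_ge_atTop 0] with v hv using le_ordinate hω hv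
  · refine Filter.tendsto_atBot_mono' _ ?_ Filter.tendsto_id
    filter_upwards [Filter.eventually_le_atBot 0] with v hv
    have := le_ordinate (b := b) hω (neg_nonneg.2 hv)
    rw [ordinate_neg] at this
    simpa using this

/-- The latitude of a point of given conformal ordinate. -/
noncomputable def latitude (ω b : ℝ) : ℝ → ℝ := Function.invFun (ordinate ω b)

theorem ordinate_latitude {ω b : ℝ} (hω : ω ∈ Ioo 0 (π / 2)) (y : ℝ) :
    ordinate ω b (latitude ω b y) = y :=
  Function.rightInverse_invFun (surjective_ordinate hω) y

theorem latitude_ordinate {ω b : ℝ} (hω : ω ∈ Ioo 0 (π / 2)) (v : ℝ) :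
    latitude ω b (ordinate ω b v) = v :=
  Function.leftInverse_invFun (strictMono_ordinate hω).injective v

theorem continuous_latitude {ω b : ℝ} (hω : ω ∈ Ioo 0 (π / 2)) : Continuous (latitude ω b) := by
  have h : latitude ω b = ((strictMono_ordinate hω).orderIsoOfSurjective _
      (surjective_ordinate (b := b) hω)).symm := by
    ext y
    apply (strictMono_ordinate (b := b) hω).injective
    rw [ordinate_latitude hω]
    exact (((strictMono_ordinate hω).orderIsoOfSurjective _
      (surjective_ordinate (b := b) hω)).apply_symm_apply y).symm
  rw [h]
  exact OrderIso.continuous _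

theorem hasDerivAt_latitude {ω b : ℝ} (hω : ω ∈ Ioo 0 (π / 2)) (y : ℝ) :
    HasDerivAt (latitude ω b) (profile ω b (latitude ω b y)) y := by
  have h := (hasDerivAt_ordinate (b := b) hω (latitude ω b y)).of_local_left_inverse
    (continuous_latitude hω).continuousAt (one_div_pos.2 (profile_pos hω _)).ne'
    (.of_forall fun y => ordinate_latitude hω y)
  rwa [one_div, inv_inv] at h

theorem latitude_neg {ω b : ℝ} (hω : ω ∈ Ioo 0 (π / 2)) (y : ℝ) :
    latitude ω b (-y) = -latitude ω b y := by
  apply (strictMono_ordinate (b := b) hω).injective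
  rw [ordinate_latitude hω, ordinate_neg, ordinate_latitude hω]

theorem latitude_add {ω b β : ℝ} (hω : ω ∈ Ioo 0 (π / 2)) (hβ : β / 2 = ordinate ω b b) (y : ℝ) :
    latitude ω b (y + β) = latitude ω b y + 2 * b := by
  apply (strictMono_ordinate (b := b) hω).injective
  rw [ordinate_latitude hω, ordinate_add_period hω, ordinate_latitude hω, ← hβ]
  ring

theorem lipschitzWith_latitude {ω b : ℝ} (hω : ω ∈ Ioo 0 (π / 2)) :
    LipschitzWith 1 (latitude ω b) := by
  refine lipschitzWith_of_nnnorm_deriv_le (fun y => (hasDerivAt_latitude hω y).differentiableAt)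
    fun y => ?_
  rw [(hasDerivAt_latitude hω y).deriv, ← NNReal.coe_le_coe, coe_nnnorm, NNReal.coe_one,
    norm_of_nonneg (profile_pos hω _).le]
  exact profile_le_one _ _ _

/-- The flat-spherical metric. -/
noncomputable def flatSpherical {ω b β : ℝ} (hω : ω ∈ Ioo 0 (π / 2))
    (hβ : β / 2 = ordinate ω b b) : RiemannianMetric β where
  inner z := (profile ω b (latitude ω b z.im) ^ 2) • innerSL ℝ
  symm z v w := by
    simp only [smul_apply]
    exact congrArg _ (real_inner_comm w v)
  pos z v hv := by
    simp only [smul_apply, smul_eq_mul]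
    exact mul_pos (pow_pos (profile_pos hω _) 2) (real_inner_self_pos.2 hv)
  continuous := by
    have h1 := continuous_profile ω b
    have h2 := continuous_latitude (b := b) hω
    have h3 := Complex.continuous_im
    fun_prop
  glide_invariant z v w := by
    have h1 : (glide z).im = -z.im := by simp [glide]
    simp only [smul_apply, h1, latitude_neg hω, profile_neg]
    exact congrArg _ (LinearIsometryEquiv.inner_map_map Complex.conjLIE v w)
  vert_invariant z v w := by
    have h1 : (vert β z).im = z.im + β + β := by
      simp [vert]
      ring
    simp only [h1, latitude_add hω hβ, profile_periodic ω b _]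

theorem isConformalFactor_flatSpherical {ω b β : ℝ} (hω : ω ∈ Ioo 0 (π / 2))
    (hβ : β / 2 = ordinate ω b b) :
    IsConformalFactor (flatSpherical hω hβ) fun z => profile ω b (latitude ω b z.im) where
  continuous := (continuous_profile ω b).comp
    ((continuous_latitude hω).comp Complex.continuous_im)
  pos z := profile_pos hω _
  inner_eq z v w := by
    rw [← flatMetric_inner (β := β) z v w]
    rfl
  conj_add_pi z := by simp [latitude_neg hω, profile_neg]
  add_period z := by
    have h1 : (z + 2 * Complex.I * β).im = z.im + β + β := by
      simp
      ring
    simp only [h1, latitude_add hω hβ, profile_periodic ω b _]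

theorem isFlatSpherical_flatSpherical {ω b β : ℝ} (hω : ω ∈ Ioo 0 (π / 2))
    (hβ : β / 2 = ordinate ω b b) : IsFlatSpherical ω b (flatSpherical hω hβ) := by
  intro u v p q p' q'
  rw [(isConformalFactor_flatSpherical hω hβ).inner_eq]
  have h1 : latitude ω b (∫ s in (0 : ℝ)..v, 1 / profile ω b s) = v := latitude_ordinate hω v
  have := profile_pos (b := b) hω v
  simp only [h1]
  field_simp

theorem integral_profile {ω b : ℝ} (hω : ω ∈ Ioo 0 (π / 2)) (hb : ω ≤ b) :
    ∫ v in (0 : ℝ)..b, profile ω b v = sin ω + (b - ω) * cos ω := by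
  have hi := (continuous_profile ω b).intervalIntegrable (μ := volume)
  rw [← intervalIntegral.integral_add_adjacent_intervals (hi 0 ω) (hi ω b)]
  congr 1
  · rw [show sin ω = ∫ v in (0 : ℝ)..ω, cos v by simp]
    refine intervalIntegral.integral_congr fun v hv => ?_
    rw [uIcc_of_le hω.1.le] at hv
    simp only [profile_of_mem_Icc ⟨hv.1, hv.2.trans hb⟩, min_eq_left hv.2]
  · rw [show (b - ω) * cos ω = ∫ v in ω..b, cos ω by simp]
    refine intervalIntegral.integral_congr fun v hv => ?_
    rw [uIcc_of_le hb] at hv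
    simp only [profile_of_mem_Icc ⟨hω.1.le.trans hv.1, hv.2⟩, min_eq_right hv.1]

theorem ordinate_self {ω b : ℝ} (hω : ω ∈ Ioo 0 (π / 2)) (hb : ω ≤ b) :
    ordinate ω b b = artanh (sin ω) + (b - ω) / cos ω := by
  have hi := (continuous_one_div_profile (b := b) hω).intervalIntegrable (μ := volume)
  rw [ordinate, ← intervalIntegral.integral_add_adjacent_intervals (hi 0 ω) (hi ω b)]
  congr 1
  · have hcos : ∀ v ∈ Icc 0 ω, 0 < cos v := fun v hv =>
      cos_pos_of_mem_Ioo ⟨by linarith [hv.1, pi_pos], by linarith [hv.2, hω.2]⟩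
    have hder : ∀ v ∈ uIcc 0 ω, HasDerivAt (fun v => artanh (sin v)) (1 / profile ω b v) v := by
      intro v hv
      rw [uIcc_of_le hω.1.le] at hv
      have h0 := hcos v hv
      have h1 := sin_sq_add_cos_sq v
      have h2 : sin v ∈ Ioo (-1 : ℝ) 1 := by
        rw [mem_Ioo, ← abs_lt, ← sq_lt_one_iff_abs_lt_one]
        nlinarith
      have h := (hasDerivAt_artanh h2).comp v (hasDerivAt_sin v)
      convert! h using 1
      rw [profile_of_mem_Icc ⟨hv.1, hv.2.trans hb⟩, min_eq_left hv.2,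
        show 1 - sin v ^ 2 = cos v ^ 2 by linarith]
      field_simp
    rw [intervalIntegral.integral_eq_sub_of_hasDerivAt hder (hi _ _)]
    simp
  · rw [show (b - ω) / cos ω = ∫ v in ω..b, 1 / cos ω by simp; ring]
    refine intervalIntegral.integral_congr fun v hv => ?_
    rw [uIcc_of_le hb] at hv
    simp only [profile_of_mem_Icc ⟨hω.1.le.trans hv.1, hv.2⟩, min_eq_right hv.1]

/-- In the coordinates $(u,v)$ the area element is $f\,du\,dv$; the domain has width $\pi$ and
consists of four copies of $0\le v\le b$. -/
theorem vol_flatSpherical {ω b β : ℝ} (hω : ω ∈ Ioo 0 (π / 2)) (hb : ω ≤ b)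
    (hβ : β / 2 = ordinate ω b b) (hβ0 : 0 < β) :
    vol (flatSpherical hω hβ) = 4 * π * (sin ω + (b - ω) * cos ω) := by
  have hpc := continuous_profile ω b
  have hlc := continuous_latitude (b := b) hω
  rw [(isConformalFactor_flatSpherical hω hβ).vol_eq hβ0]
  simp only [Complex.add_im, Complex.ofReal_im, Complex.mul_im, Complex.ofReal_re, Complex.I_im,
    Complex.I_re, mul_one, mul_zero, add_zero, zero_add, intervalIntegral.integral_const]
  have h1 : ∫ y in (-β)..β, profile ω b (latitude ω b y) ^ 2 =
      2 * ∫ y in (-(β / 2))..(β / 2), profile ω b (latitude ω b y) ^ 2 := by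
    have hc : Continuous fun y => profile ω b (latitude ω b y) ^ 2 := by fun_prop
    have hi := hc.intervalIntegrable (μ := volume)
    have hp : Function.Periodic (fun y => profile ω b (latitude ω b y) ^ 2) β := fun y => by
      simp only [latitude_add hω hβ, profile_periodic ω b _]
    have h3 := hp.intervalIntegral_add_eq (-β) (-(β / 2))
    have h4 := hp.intervalIntegral_add_eq 0 (-(β / 2))
    rw [show -(β / 2) + β = β / 2 by ring, neg_add_cancel] at h3
    rw [show -(β / 2) + β = β / 2 by ring, zero_add] at h4
    rw [← intervalIntegral.integral_add_adjacent_intervals (hi (-β) 0) (hi 0 β), h3, h4, two_mul]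
  have h2 : ∫ y in (0 : ℝ)..β / 2, profile ω b (latitude ω b y) ^ 2 =
      ∫ v in (0 : ℝ)..b, profile ω b v := by
    have h3 := intervalIntegral.integral_comp_mul_deriv (a := 0) (b := β / 2)
      (fun y _ => hasDerivAt_latitude (b := b) hω y) (by fun_prop) hpc
    have h4 : latitude ω b 0 = 0 := by
      simpa [ordinate] using latitude_ordinate (b := b) hω 0
    rw [h4, hβ, latitude_ordinate hω] at h3
    rw [← h3, hβ]
    refine intervalIntegral.integral_congr fun y _ => ?_
    simp only [Function.comp, pow_two]
  rw [h1, integral_even (by fun_prop) (fun y => by rw [latitude_neg hω, profile_neg]), h2,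
    integral_profile hω hb, smul_eq_mul]
  ring

end Profile

/-! ### Lower bounds for the least lengths of the flat-spherical metric. -/

section LowerBounds

open MeasureTheory Set

theorem ae_differentiableAt_of_lipschitzOnWith {F : Type*} [NormedAddCommGroup F]
    [NormedSpace ℝ F] [FiniteDimensional ℝ F] {f : ℝ → F} {C : NNReal}
    (hf : LipschitzOnWith C f (Icc 0 1)) : ∀ᵐ s, s ∈ Ioo (0 : ℝ) 1 → DifferentiableAt ℝ f s := by
  filter_upwards [hf.ae_differentiableWithinAt_of_mem] with s hs h
  exact (hs (Ioo_subset_Icc_self h)).differentiableAt (Icc_mem_nhds h.1 h.2)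

/-- A function that varies more slowly than the arc length bounds the length from below. -/
theorem IsConformalFactor.abs_sub_le_length {β : ℝ} {g : RiemannianMetric β} {q : ℂ → ℝ}
    (h : IsConformalFactor g q) {c : ℝ → ℂ} {C : NNReal} (hc : LipschitzOnWith C c (Icc 0 1))
    {Φ : ℝ → ℝ} {C' : NNReal} (hΦ : LipschitzOnWith C' Φ (Icc 0 1))
    (hder : ∀ᵐ s, s ∈ Ioo (0 : ℝ) 1 → |deriv Φ s| ≤ q (c s) * ‖deriv c s‖) :
    |Φ 1 - Φ 0| ≤ length g c := by
  have hac : AbsolutelyContinuousOnInterval Φ 0 1 :=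
    LipschitzOnWith.absolutelyContinuousOnInterval (K := C') (by rwa [uIcc_of_le zero_le_one])
  have hcc := hc.continuousOn
  have hqc : ContinuousOn (fun s => q (c s)) (Icc 0 1) := h.continuous.comp_continuousOn hcc
  obtain ⟨B, hB⟩ := isCompact_Icc.exists_bound_of_continuousOn hqc
  -- Without integrability the integral defining the length would be the default value 0; the
  -- Lipschitz bound on $c$ supplies it.
  have hint : IntegrableOn (fun s => q (c s) * ‖deriv c s‖) (Ioo 0 1) := by
    refine Integrable.of_bound ?_ (B * C) ?_
    · refine AEStronglyMeasurable.mul ?_ (measurable_deriv c).norm.aestronglyMeasurable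
      exact (hqc.mono Ioo_subset_Icc_self).aestronglyMeasurable measurableSet_Ioo
    · refine (ae_restrict_iff' measurableSet_Ioo).2 (.of_forall fun s hs => ?_)
      rw [norm_mul, norm_norm]
      have h1 := hB s (Ioo_subset_Icc_self hs)
      have h2 : ‖deriv c s‖ ≤ C :=
        norm_deriv_le_of_lipschitzOn (Icc_mem_nhds hs.1 hs.2) hc
      have := (norm_nonneg _).trans h1
      gcongr
  have hle : ∫ s in (0 : ℝ)..1, |deriv Φ s| ≤ ∫ s in (0 : ℝ)..1, q (c s) * ‖deriv c s‖ := by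
    rw [intervalIntegral.integral_of_le zero_le_one, intervalIntegral.integral_of_le zero_le_one,
      integral_Ioc_eq_integral_Ioo, integral_Ioc_eq_integral_Ioo]
    refine integral_mono_ae ?_ hint ((ae_restrict_iff' measurableSet_Ioo).2 hder)
    have := hac.intervalIntegrable_deriv.abs
    exact (intervalIntegrable_iff_integrableOn_Ioo_of_le zero_le_one).1 this
  rw [← hac.integral_deriv_eq_sub]
  calc _ ≤ ∫ s in (0 : ℝ)..1, |deriv Φ s| :=
        intervalIntegral.abs_integral_le_integral_abs zero_le_one
    _ ≤ _ := hle
    _ = length g c := by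
      rw [length]
      simp only [h.sqrt_inner]

theorem le_leastLength {β : ℝ} {g : RiemannianMetric β} {q : ℂ → ℝ} (h : IsConformalFactor g q)
    {T : Set (deckGroup β)} {τ : deckGroup β} (hT : τ ∈ T) (hτ : IsAffineDeck τ) {l : ℝ}
    (hl : ∀ γ : C(UnitAddCircle, KleinBottle β), ∀ c : ℝ → ℂ,
      (∃ τ ∈ T, γ.Homotopic (deckLoop β τ)) → IsRectifiableLift γ c → l ≤ length g c) :
    l ≤ leastLength g T := by
  refine le_csInf ?_ ?_
  -- The set of lengths must be nonempty, since the infimum of the empty set is 0; the segment from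
  -- $0$ to $\tau 0$ provides a member.
  · obtain ⟨γ, c, hγ, hc, -⟩ := h.exists_rectifiableLift hτ (a := 0) (b := 1) zero_lt_one
      (e := fun s => 0 + s * (τ • 0 - 0)) (e' := fun _ => τ • 0 - 0)
      (fun s => by
        simpa using ((Complex.ofRealCLM.hasDerivAt (x := s)).mul_const (τ • (0 : ℂ))))
      continuous_const (by simp)
    exact ⟨_, γ, c, ⟨τ, hT, hγ⟩, hc, rfl⟩
  · rintro L ⟨γ, c, hγ, hc, rfl⟩
    exact hl γ c hγ hc

theorem abs_deriv_le_of_lipschitzWith_one {φ u : ℝ → ℝ} (hφ : LipschitzWith 1 φ) {a b s : ℝ}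
    (ha : HasDerivAt (fun s => φ (u s)) a s) (hb : HasDerivAt u b s) : |a| ≤ |b| := by
  rw [hasDerivAt_iff_tendsto_slope] at ha hb
  refine le_of_tendsto_of_tendsto ha.abs hb.abs (.of_forall fun x => ?_)
  simp only [slope_def_field, abs_div]
  refine div_le_div_of_nonneg_right ?_ (abs_nonneg _)
  simpa [dist_eq] using hφ.dist_le_mul (u x) (u s)

/-- The nearest point of `[-π/2, π/2]`. -/
noncomputable def clamp (x : ℝ) : ℝ := max (-(π / 2)) (min (π / 2) x)

theorem lipschitzWith_clamp : LipschitzWith 1 clamp :=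
  (LipschitzWith.id.const_min _).const_max _

theorem clamp_neg (x : ℝ) : clamp (-x) = -clamp x := by
  have := pi_pos
  unfold clamp
  rcases le_total x (π / 2) with h | h <;> rcases le_total (-(π / 2)) x with h' | h'
  · rw [min_eq_right (by linarith), min_eq_right h, max_eq_right (by linarith), max_eq_right h']
  · rw [min_eq_left (by linarith), min_eq_right h, max_eq_right (by linarith), max_eq_left h',
      neg_neg]
  · rw [min_eq_right (by linarith), min_eq_left h, max_eq_left (by linarith),
      max_eq_right (by linarith)]
  · linarith

theorem abs_clamp (x : ℝ) : |clamp x| = min |x| (π / 2) := by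
  have hpi := pi_pos
  have key : ∀ x, 0 ≤ x → |clamp x| = min |x| (π / 2) := by
    intro x hx
    have h0 : 0 ≤ min (π / 2) x := le_min (by positivity) hx
    rw [clamp, max_eq_right (by linarith), abs_of_nonneg h0, abs_of_nonneg hx, min_comm]
  rcases le_total 0 x with h | h
  · exact key x h
  · rw [← abs_neg, ← clamp_neg, key _ (neg_nonneg.2 h), abs_neg]

/-- The cosine of the spherical distance between the points of latitudes `v₀`, `v` and of
longitudes `x₀`, `x`. -/
noncomputable def cosDist (v₀ x₀ v x : ℝ) : ℝ := cos v₀ * cos v * cos (x - x₀) + sin v₀ * sin v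

/-- The first two squares form the squared spherical gradient of `cosDist`; thus $|\nabla
H|^2=1-H^2$, as for the cosine of a distance. -/
theorem cosDist_identity (v₀ x₀ v x : ℝ) :
    (sin v₀ * cos v - cos v₀ * sin v * cos (x - x₀)) ^ 2 + (cos v₀ * sin (x - x₀)) ^ 2 +
      cosDist v₀ x₀ v x ^ 2 = 1 := by
  have h0 := sin_sq_add_cos_sq v₀
  have h1 := sin_sq_add_cos_sq v
  have h2 := sin_sq_add_cos_sq (x - x₀)
  unfold cosDist
  linear_combination (cos v₀ ^ 2) * h2 +
    (sin v₀ ^ 2 + cos v₀ ^ 2 * cos (x - x₀) ^ 2) * h1 + h0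

theorem cosDist_sq_le (v₀ x₀ v x : ℝ) : cosDist v₀ x₀ v x ^ 2 ≤ 1 := by
  have := cosDist_identity v₀ x₀ v x
  nlinarith [sq_nonneg (sin v₀ * cos v - cos v₀ * sin v * cos (x - x₀)),
    sq_nonneg (cos v₀ * sin (x - x₀))]

theorem mul_cosDist_mem_Ioo {l : ℝ} (hl : l ∈ Ico (0 : ℝ) 1) (v₀ x₀ v x : ℝ) :
    l * cosDist v₀ x₀ v x ∈ Ioo (-1 : ℝ) 1 := by
  rw [mem_Ioo, ← abs_lt, abs_mul, abs_of_nonneg hl.1]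
  have := (sq_le_one_iff_abs_le_one _).1 (cosDist_sq_le v₀ x₀ v x)
  nlinarith [hl.1, hl.2, abs_nonneg (cosDist v₀ x₀ v x)]

/-- The function $\arcsin(lH)$ varies no faster than spherical arc length, because
$l^2(1-H^2)\le1-l^2H^2$. Taking $l<1$ keeps the arcsine differentiable at the base point and at its
antipode. -/
theorem exists_hasDerivAt_arcsin_cosDist {l : ℝ} (hl : l ∈ Ico (0 : ℝ) 1) (v₀ x₀ : ℝ)
    {v x : ℝ → ℝ} {v' x' s : ℝ} (hv : HasDerivAt v v' s) (hx : HasDerivAt x x' s) :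
    ∃ D, HasDerivAt (fun s => arcsin (l * cosDist v₀ x₀ (v s) (x s))) D s ∧
      D ^ 2 ≤ v' ^ 2 + (cos (v s) * x') ^ 2 := by
  have hmem := mul_cosDist_mem_Ioo hl v₀ x₀ (v s) (x s)
  have hid := cosDist_identity v₀ x₀ (v s) (x s)
  have hh : HasDerivAt (fun s => cosDist v₀ x₀ (v s) (x s))
      ((sin v₀ * cos (v s) - cos v₀ * sin (v s) * cos (x s - x₀)) * v' +
        -(cos v₀ * sin (x s - x₀)) * (cos (v s) * x')) s := by
    have h1 := ((hv.cos.const_mul (cos v₀)).mul (hx.sub_const x₀).cos).add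
      (hv.sin.const_mul (sin v₀))
    convert! h1 using 1
    ring
  have hd := (hasDerivAt_arcsin hmem.1.ne' hmem.2.ne).comp s (hh.const_mul l)
  refine ⟨_, hd, ?_⟩
  have hpos := one_sub_sq_pos hmem
  set H := cosDist v₀ x₀ (v s) (x s)
  set a := sin v₀ * cos (v s) - cos v₀ * sin (v s) * cos (x s - x₀)
  set b := cos v₀ * sin (x s - x₀)
  set w := cos (v s) * x'
  rw [mul_pow, div_pow, sq_sqrt hpos.le, one_pow, one_div, inv_mul_le_iff₀ hpos]
  have h1 : (a * v' + -b * w) ^ 2 ≤ (a ^ 2 + b ^ 2) * (v' ^ 2 + w ^ 2) := by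
    nlinarith [sq_nonneg (a * w + b * v')]
  have h2 : l ^ 2 * (a ^ 2 + b ^ 2) ≤ 1 - (l * H) ^ 2 := by
    have : l ^ 2 ≤ 1 := by nlinarith [hl.1, hl.2]
    calc l ^ 2 * (a ^ 2 + b ^ 2) = l ^ 2 - (l * H) ^ 2 := by linear_combination l ^ 2 * hid
      _ ≤ _ := by linarith
  calc (l * (a * v' + -b * w)) ^ 2 = l ^ 2 * (a * v' + -b * w) ^ 2 := by ring
    _ ≤ l ^ 2 * ((a ^ 2 + b ^ 2) * (v' ^ 2 + w ^ 2)) := by gcongr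
    _ = l ^ 2 * (a ^ 2 + b ^ 2) * (v' ^ 2 + w ^ 2) := by ring
    _ ≤ _ := by gcongr

theorem contDiff_arcsin_cosDist {l : ℝ} (hl : l ∈ Ico (0 : ℝ) 1) (v₀ x₀ : ℝ) :
    ContDiff ℝ 1 fun p : ℝ × ℝ => arcsin (l * cosDist v₀ x₀ p.1 p.2) := by
  rw [contDiff_iff_contDiffAt]
  intro p
  have hmem := mul_cosDist_mem_Ioo hl v₀ x₀ p.1 p.2
  have h1 : ContDiff ℝ 1 fun p : ℝ × ℝ => l * cosDist v₀ x₀ p.1 p.2 := by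
    unfold cosDist
    fun_prop
  exact ContDiffAt.comp (g := arcsin) (f := fun p : ℝ × ℝ => l * cosDist v₀ x₀ p.1 p.2) p
    (contDiffAt_arcsin hmem.1.ne' hmem.2.ne) h1.contDiffAt

theorem exists_lipschitzOnWith_comp {P : ℝ × ℝ → ℝ} (hP : ContDiff ℝ 1 P) {v x : ℝ → ℝ}
    {C C' : NNReal} (hv : LipschitzOnWith C v (Icc 0 1)) (hx : LipschitzOnWith C' x (Icc 0 1)) :
    ∃ K, LipschitzOnWith K (fun s => P (v s, x s)) (Icc 0 1) := by
  have h1 := hv.prodMk hx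
  obtain ⟨K, hK⟩ := hP.locallyLipschitz.locallyLipschitzOn.exists_lipschitzOnWith_of_compact
    (isCompact_Icc.image_of_continuousOn h1.continuousOn)
  exact ⟨_, hK.comp h1 (mapsTo_image _ _)⟩

section FlatSpherical

variable {ω b β : ℝ} (hω : ω ∈ Ioo 0 (π / 2)) (hβ : β / 2 = ordinate ω b b)
include hω hβ

theorem le_lHor_flatSpherical (hβ0 : 0 < β) :
    2 * π * cos ω ≤ lHor (flatSpherical hω hβ) := by
  have h := isConformalFactor_flatSpherical hω hβ
  refine le_leastLength h (mem_singleton _)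
    (pow_two (σ β) ▸ (isAffineDeck_σ β).mul (isAffineDeck_σ β)) ?_
  rintro γ c ⟨τ, rfl, hγ⟩ hc
  have hend := end_of_homotopic_σ_sq hβ0 hγ hc
  obtain ⟨⟨C, hC⟩, -⟩ := hc
  have hcos := cos_pos_of_mem hω
  have hlip : LipschitzOnWith (‖cos ω‖₊ * (1 * C)) (fun s => cos ω * (c s).re) (Icc 0 1) :=
    (lipschitzWith_smul (cos ω)).comp_lipschitzOnWith
      ((RCLike.lipschitzWith_re (K := ℂ)).comp_lipschitzOnWith hC)
  have := h.abs_sub_le_length hC hlip (by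
    filter_upwards [ae_differentiableAt_of_lipschitzOnWith hC] with s hs hs'
    have h1 : HasDerivAt (fun s => cos ω * (c s).re) (cos ω * (deriv c s).re) s :=
      (Complex.reCLM.hasFDerivAt.comp_hasDerivAt s (hs hs').hasDerivAt).const_mul _
    rw [h1.deriv, abs_mul, abs_of_pos hcos]
    exact mul_le_mul (cos_le_profile hω _) (Complex.abs_re_le_norm _) (abs_nonneg _)
      (profile_pos hω _).le)
  rw [hend] at this
  refine le_trans (le_of_eq ?_) this
  rw [show cos ω * ((c 0).re + 2 * π) - cos ω * (c 0).re = 2 * π * cos ω by ring, abs_of_pos]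
  positivity

theorem le_lVert_flatSpherical (hb : 0 < b) (hβ0 : 0 < β) :
    4 * b ≤ lVert (flatSpherical hω hβ) := by
  have h := isConformalFactor_flatSpherical hω hβ
  refine le_leastLength h (mem_singleton _) (isAffineDeck_t β) ?_
  rintro γ c ⟨τ, rfl, hγ⟩ hc
  have hend := end_of_homotopic_t hβ0 hγ hc
  obtain ⟨⟨C, hC⟩, -⟩ := hc
  have hlip : LipschitzOnWith (1 * (1 * C)) (fun s => latitude ω b (c s).im) (Icc 0 1) :=
    (lipschitzWith_latitude hω).comp_lipschitzOnWith
      ((RCLike.lipschitzWith_im (K := ℂ)).comp_lipschitzOnWith hC)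
  have := h.abs_sub_le_length hC hlip (by
    filter_upwards [ae_differentiableAt_of_lipschitzOnWith hC] with s hs hs'
    have h1 : HasDerivAt (fun s => latitude ω b (c s).im)
        (profile ω b (latitude ω b (c s).im) * (deriv c s).im) s :=
      (hasDerivAt_latitude hω _).comp s
        (Complex.imCLM.hasFDerivAt.comp_hasDerivAt s (hs hs').hasDerivAt)
    rw [h1.deriv, abs_mul, abs_of_pos (profile_pos hω _)]
    exact mul_le_mul_of_nonneg_left (Complex.abs_im_le_norm _) (profile_pos hω _).le)
  refine le_trans (le_of_eq ?_) this
  rcases hend with hend | hend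
  · rw [hend, show (c 0).im + 2 * β = (c 0).im + β + β by ring, latitude_add hω hβ,
      latitude_add hω hβ, show ∀ x : ℝ, x + 2 * b + 2 * b - x = 4 * b by intro x; ring,
      abs_of_pos (by positivity)]
  · rw [show (c 0).im = (c 1).im + β + β by linarith, latitude_add hω hβ,
      latitude_add hω hβ, show ∀ x : ℝ, x - (x + 2 * b + 2 * b) = -(4 * b) by intro x; ring,
      abs_neg, abs_of_pos (by positivity)]

/-- Truncating the latitude at the poles maps the bottle's lifted curve to the unit sphere without
increasing length. A glide reflection sends a point to its antipode, so the image joins points at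
distance $\pi$. -/
theorem le_lSigma_flatSpherical (hβ0 : 0 < β) : π ≤ lSigma (flatSpherical hω hβ) := by
  have h := isConformalFactor_flatSpherical hω hβ
  refine le_leastLength h (mem_insert _ _) (isAffineDeck_σ β) ?_
  rintro γ c hγ hc
  obtain ⟨hx, n, hy⟩ := end_of_homotopic_glide hβ0 hγ hc
  obtain ⟨⟨C, hC⟩, -⟩ := hc
  have hper : Function.Periodic (fun y => profile ω b (latitude ω b y)) β := fun y => by
    simp only [latitude_add hω hβ, profile_periodic ω b _]
  -- The curve is closed by a glide reflection of axis $y=n\beta$; measuring latitude from this axis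
  -- makes the end latitudes opposite.
  set u : ℝ → ℝ := fun s => latitude ω b ((c s).im - n * β) with hu
  set v : ℝ → ℝ := fun s => clamp (u s) with hv
  have hq : ∀ s, profile ω b (latitude ω b (c s).im) = profile ω b (u s) := fun s =>
    (hper.sub_int_mul_eq n).symm
  have hcosv : ∀ s, 0 ≤ cos (v s) ∧ cos (v s) ≤ profile ω b (u s) := by
    intro s
    have h1 : cos (v s) = cos (min |u s| (π / 2)) := by rw [← abs_clamp, cos_abs]
    refine ⟨?_, h1.trans_le (cos_min_le_profile hω _)⟩
    rw [h1]
    exact cos_nonneg_of_neg_pi_div_two_le_of_le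
      ((neg_nonpos.2 pi_div_two_pos.le).trans (le_min (abs_nonneg _) pi_div_two_pos.le))
      (min_le_right _ _)
  have hre : LipschitzOnWith (1 * C) (fun s => (c s).re) (Icc 0 1) :=
    (RCLike.lipschitzWith_re (K := ℂ)).comp_lipschitzOnWith hC
  have him : LipschitzOnWith (1 * C) (fun s => (c s).im) (Icc 0 1) :=
    (RCLike.lipschitzWith_im (K := ℂ)).comp_lipschitzOnWith hC
  have hsub : LipschitzWith 1 fun y : ℝ => y - n * β :=
    LipschitzWith.of_dist_le_mul fun x y => by simp [dist_eq]
  have hvlip : LipschitzOnWith (1 * (1 * (1 * (1 * C)))) v (Icc 0 1) :=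
    lipschitzWith_clamp.comp_lipschitzOnWith ((lipschitzWith_latitude hω).comp_lipschitzOnWith
      (hsub.comp_lipschitzOnWith him))
  have hv1 : v 1 = -v 0 := by
    simp only [hv, hu]
    rw [← clamp_neg, ← latitude_neg hω, hy]
    congr 2
    ring
  -- With $l=\sin\mu$, the regularized distance function passes from $\mu$ to $-\mu$; then
  -- $\mu\to\pi/2$.
  have hmain : ∀ μ ∈ Ico 0 (π / 2), 2 * μ ≤ length (flatSpherical hω hβ) c := by
    intro μ hμ
    have hl : sin μ ∈ Ico (0 : ℝ) 1 := by
      refine ⟨sin_nonneg_of_nonneg_of_le_pi hμ.1 (by linarith [hμ.2, pi_pos]), ?_⟩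
      rw [← sin_pi_div_two]
      exact sin_lt_sin_of_lt_of_le_pi_div_two (by linarith [hμ.1, pi_pos]) le_rfl hμ.2
    obtain ⟨C', hΦlip⟩ := exists_lipschitzOnWith_comp (contDiff_arcsin_cosDist hl (v 0) (c 0).re)
      hvlip hre
    set Φ : ℝ → ℝ := fun s => arcsin (sin μ * cosDist (v 0) (c 0).re (v s) (c s).re) with hΦ
    have hΦ0 : Φ 0 = μ := by
      have : cosDist (v 0) (c 0).re (v 0) (c 0).re = 1 := by
        rw [cosDist, sub_self, cos_zero]
        linear_combination sin_sq_add_cos_sq (v 0)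
      simp only [hΦ, this, mul_one]
      exact arcsin_sin (by linarith [hμ.1, pi_pos]) hμ.2.le
    have hΦ1 : Φ 1 = -μ := by
      have : cosDist (v 0) (c 0).re (v 1) (c 1).re = -1 := by
        rw [cosDist, hv1, hx, add_sub_cancel_left, cos_pi, cos_neg, sin_neg]
        linear_combination -sin_sq_add_cos_sq (v 0)
      simp only [hΦ, this, mul_neg, mul_one, arcsin_neg]
      rw [arcsin_sin (by linarith [hμ.1, pi_pos]) hμ.2.le]
    have := h.abs_sub_le_length hC hΦlip (by
      filter_upwards [ae_differentiableAt_of_lipschitzOnWith hC,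
        ae_differentiableAt_of_lipschitzOnWith hvlip] with s hs hvs hs'
      have h1 : HasDerivAt (fun s => (c s).re) (deriv c s).re s :=
        Complex.reCLM.hasFDerivAt.comp_hasDerivAt s (hs hs').hasDerivAt
      have h2 : HasDerivAt (fun s => (c s).im - n * β) (deriv c s).im s :=
        (Complex.imCLM.hasFDerivAt.comp_hasDerivAt s (hs hs').hasDerivAt).sub_const _
      have h3 : HasDerivAt u (profile ω b (u s) * (deriv c s).im) s :=
        (hasDerivAt_latitude hω _).comp s h2
      have h4 := abs_deriv_le_of_lipschitzWith_one lipschitzWith_clamp (hvs hs').hasDerivAt h3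
      obtain ⟨D, hD, hDle⟩ := exists_hasDerivAt_arcsin_cosDist hl (v 0) (c 0).re
        (hvs hs').hasDerivAt h1
      rw [hD.deriv]
      refine abs_le_of_sq_le_sq ?_ (mul_nonneg (profile_pos hω _).le (norm_nonneg _))
      rw [hq, mul_pow, ← Complex.normSq_eq_norm_sq, Complex.normSq_apply]
      have h5 := sq_le_sq.2 h4
      have h6 : (cos (v s) * (deriv c s).re) ^ 2 ≤ (profile ω b (u s) * (deriv c s).re) ^ 2 := by
        rw [mul_pow, mul_pow]
        gcongr
        · exact (hcosv s).1
        · exact (hcosv s).2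
      nlinarith)
    rw [hΦ0, hΦ1, abs_sub_comm, sub_neg_eq_add, abs_of_nonneg (by linarith [hμ.1])] at this
    linarith
  refine le_of_forall_lt_imp_le_of_dense fun a ha => ?_
  rcases le_or_gt 0 a with h0 | h0
  · have := hmain (a / 2) ⟨by positivity, by linarith⟩
    linarith
  · exact h0.le.trans (length_nonneg _ _)

end FlatSpherical

end LowerBounds

/-! ### The parameter $\omega$, and the algebra of the constants. -/

section Parameter

open Set Filter Topology

theorem sin_mem_of_mem {ω : ℝ} (hω : ω ∈ Ioo 0 (π / 2)) : sin ω ∈ Ioo (0 : ℝ) 1 := by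
  refine ⟨sin_pos_of_pos_of_lt_pi hω.1 (by linarith [hω.2, pi_pos]), ?_⟩
  rw [← sin_pi_div_two]
  exact sin_lt_sin_of_lt_of_le_pi_div_two (by linarith [hω.1, pi_pos]) le_rfl hω.2

/-- Half-angle formulas give $\tan^2(\pi/4+\omega/2)=(1+\sin\omega)/(1-\sin\omega)$; the logarithm
is the Mercator ordinate of latitude $\omega$. -/
theorem log_tan_eq_artanh_sin {ω : ℝ} (hω : ω ∈ Ioo 0 (π / 2)) :
    log (tan (π / 4 + ω / 2)) = artanh (sin ω) := by
  have h2 : cos (2 * (π / 4 + ω / 2)) = -sin ω := by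
    rw [← cos_add_pi_div_two]
    congr 1
    ring
  have hc : cos (π / 4 + ω / 2) ^ 2 = (1 - sin ω) / 2 := by
    rw [cos_two_mul] at h2
    linarith
  have hs : sin (π / 4 + ω / 2) ^ 2 = (1 + sin ω) / 2 := by
    linarith [sin_sq_add_cos_sq (π / 4 + ω / 2)]
  have htan : 0 < tan (π / 4 + ω / 2) :=
    tan_pos_of_pos_of_lt_pi_div_two (by linarith [hω.1, pi_pos]) (by linarith [hω.2])
  have hsq : (1 + sin ω) / (1 - sin ω) = tan (π / 4 + ω / 2) ^ 2 := by
    rw [tan_eq_sin_div_cos, div_pow, hs, hc, div_div_div_cancel_right₀ two_ne_zero]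
  rw [artanh, hsq, sqrt_sq htan.le]

/-- The height `b - ω` of the flat zone, as a function of `ω`. -/
noncomputable def flatHeight (ω : ℝ) : ℝ := tan ω - ω + √(tan ω ^ 2 - ω * tan ω + ω ^ 2)

/-- The conformal type as a function of `ω`. -/
noncomputable def modulus (ω : ℝ) : ℝ := 2 * artanh (sin ω) + 2 / cos ω * flatHeight ω

theorem strictMonoOn_tan_sub : StrictMonoOn (fun ω => tan ω - ω) (Ioo 0 (π / 2)) := by
  have hder : ∀ ω ∈ Ioo 0 (π / 2), HasDerivAt (fun ω => tan ω - ω) (1 / cos ω ^ 2 - 1) ω :=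
    fun ω hω => (hasDerivAt_tan (cos_pos_of_mem hω).ne').sub (hasDerivAt_id ω)
  refine strictMonoOn_of_deriv_pos (convex_Ioo _ _)
    (fun ω hω => (hder ω hω).continuousAt.continuousWithinAt) fun ω hω => ?_
  rw [interior_Ioo] at hω
  rw [(hder ω hω).deriv, sub_pos, lt_div_iff₀ (pow_pos (cos_pos_of_mem hω) 2), one_mul]
  nlinarith [sin_sq_add_cos_sq ω, (sin_mem_of_mem hω).1]

theorem tan_sub_pos {ω : ℝ} (hω : ω ∈ Ioo 0 (π / 2)) : 0 < tan ω - ω :=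
  sub_pos.2 (lt_tan hω.1 hω.2)

theorem flatHeight_pos {ω : ℝ} (hω : ω ∈ Ioo 0 (π / 2)) : 0 < flatHeight ω :=
  add_pos_of_pos_of_nonneg (tan_sub_pos hω) (sqrt_nonneg _)

theorem strictMonoOn_flatHeight : StrictMonoOn flatHeight (Ioo 0 (π / 2)) := by
  intro x hx y hy hxy
  have h1 := strictMonoOn_tan_sub hx hy hxy
  simp only at h1
  -- With $e=\tan\omega-\omega$ the radicand is $\omega^2+\omega e+e^2$, and both $\omega$ and $e$
  -- are positive and increasing.
  refine add_lt_add_of_lt_of_le h1 (sqrt_le_sqrt ?_)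
  have hx0 := tan_sub_pos hx
  nlinarith [hx.1, hy.1]

theorem strictMonoOn_modulus : StrictMonoOn modulus (Ioo 0 (π / 2)) := by
  intro x hx y hy hxy
  have h1 : artanh (sin x) < artanh (sin y) :=
    artanh_lt_artanh (by linarith [(sin_mem_of_mem hx).1]) (sin_mem_of_mem hy).2
      (sin_lt_sin_of_lt_of_le_pi_div_two (by linarith [hx.1, pi_pos]) hy.2.le hxy)
  have h2 : 2 / cos x ≤ 2 / cos y := by
    have := cos_le_cos_of_nonneg_of_le_pi hx.1.le (by linarith [hy.2, pi_pos]) hxy.le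
    have := cos_pos_of_mem hy
    gcongr
  have h3 := strictMonoOn_flatHeight hx hy hxy
  have h4 : 2 / cos x * flatHeight x ≤ 2 / cos y * flatHeight y :=
    mul_le_mul h2 h3.le (flatHeight_pos hx).le (by have := cos_pos_of_mem hy; positivity)
  unfold modulus
  linarith

theorem continuousAt_modulus {ω : ℝ} (hω : ω ∈ Ico 0 (π / 2)) : ContinuousAt modulus ω := by
  have hc : 0 < cos ω := cos_pos_of_mem_Ioo ⟨by linarith [hω.1, pi_pos], hω.2⟩
  have ht : ContinuousAt tan ω := (hasDerivAt_tan hc.ne').continuousAt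
  have hs : sin ω ∈ Ioo (-1 : ℝ) 1 := by
    rw [mem_Ioo, ← abs_lt, ← sq_lt_one_iff_abs_lt_one]
    nlinarith [sin_sq_add_cos_sq ω]
  have ha : ContinuousAt (fun ω => artanh (sin ω)) ω :=
    (hasDerivAt_artanh hs).continuousAt.comp (f := sin) continuous_sin.continuousAt
  unfold modulus flatHeight
  have := hc.ne'
  fun_prop (disch := assumption)

theorem tendsto_modulus_atTop : Tendsto modulus (𝓝[<] (π / 2)) atTop := by
  have h1 : Tendsto (fun ω => tan ω - π / 2) (𝓝[<] (π / 2)) atTop :=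
    tendsto_atTop_add_const_right _ _ tendsto_tan_pi_div_two
  refine tendsto_atTop_mono' _ ?_ h1
  filter_upwards [Ioo_mem_nhdsLT (show (0 : ℝ) < π / 2 by positivity)] with ω hω
  have h2 := artanh_nonneg (sin_mem_of_mem hω).1.le
  have h3 : 1 ≤ 2 / cos ω := by
    rw [le_div_iff₀ (cos_pos_of_mem hω)]
    linarith [cos_le_one ω]
  have h4 : flatHeight ω ≤ 2 / cos ω * flatHeight ω :=
    le_mul_of_one_le_left (flatHeight_pos hω).le h3
  have h5 : tan ω - ω ≤ flatHeight ω := le_add_of_nonneg_right (sqrt_nonneg _)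
  unfold modulus
  linarith [hω.2]

/-- The modulus increases strictly and continuously from $0$ to infinity. -/
theorem existsUnique_modulus_eq {β : ℝ} (hβ : 0 < β) :
    ∃! ω : ℝ, ω ∈ Ioo 0 (π / 2) ∧ β = modulus ω := by
  have hpi : (0 : ℝ) < π / 2 := by positivity
  have h0 : Tendsto modulus (𝓝[>] 0) (𝓝 0) := by
    have h := (continuousAt_modulus (left_mem_Ico.2 hpi)).tendsto
    have hm : modulus 0 = 0 := by simp [modulus, flatHeight]
    rw [hm] at h
    exact h.mono_left nhdsWithin_le_nhds
  have := right_nhdsWithin_Ioo_neBot hpi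
  have himg := isPreconnected_Ioo.intermediate_value_Ioi (s := Ioo 0 (π / 2)) (l₁ := 𝓝[>] 0)
    (l₂ := 𝓝[<] (π / 2)) (le_principal_iff.2 (Ioo_mem_nhdsGT hpi))
    (le_principal_iff.2 (Ioo_mem_nhdsLT hpi))
    (fun ω hω => (continuousAt_modulus (Ioo_subset_Ico_self hω)).continuousWithinAt) h0
    tendsto_modulus_atTop
  obtain ⟨ω, hω, rfl⟩ := himg hβ
  exact ⟨ω, ⟨hω, rfl⟩, fun ω' h => (strictMonoOn_modulus.injOn hω h.1 h.2).symm⟩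

theorem add_add_cube_ge {p q r : ℝ} (hp : 0 ≤ p) (hq : 0 ≤ q) (hr : 0 ≤ r) :
    27 * (p * q * r) ≤ (p + q + r) ^ 3 := by
  nlinarith [mul_nonneg hp (sq_nonneg (q - r)), mul_nonneg hq (sq_nonneg (p - r)),
    mul_nonneg hr (sq_nonneg (p - q)), mul_nonneg (add_nonneg (add_nonneg hp hq) hr)
      (add_nonneg (add_nonneg (sq_nonneg (p - q)) (sq_nonneg (q - r))) (sq_nonneg (p - r)))]

/-- The bound of the systolic inequality is a square root. -/
theorem bound_eq_sqrt {ω b T k V : ℝ} (hk : 0 < k) (hb0 : 0 < b) (hb : ω < b) (hN : 0 < 2 * b - ω)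
    (hT : T * (2 * b - ω) = b ^ 2 - ω ^ 2) (hkT : k ^ 2 * (1 + T ^ 2) = 1) (hV : 0 ≤ V) :
    √π / (3 * √3) *
      ((b ^ 4 - 4 * b * ω + ω ^ 2 + ω ^ 4 - 2 * b ^ 2 * (-2 + ω ^ 2)) ^ ((1 : ℝ) / 4) *
        (2 * b - ω) / ((b - ω) * √((b - ω) * b))) * V ^ ((3 : ℝ) / 2) =
    √(π * (2 * b - ω) ^ 3 * V ^ 3 / (27 * k * b * (b - ω) ^ 3)) := by
  have hx : 0 < b - ω := sub_pos.2 hb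
  have hP : b ^ 4 - 4 * b * ω + ω ^ 2 + ω ^ 4 - 2 * b ^ 2 * (-2 + ω ^ 2) =
      ((2 * b - ω) / k) ^ 2 := by
    -- A sum of two squares in ratio $\tan\omega$, so the fourth root becomes a square root.
    have h1 : b ^ 4 - 4 * b * ω + ω ^ 2 + ω ^ 4 - 2 * b ^ 2 * (-2 + ω ^ 2) =
        (2 * b - ω) ^ 2 + (b ^ 2 - ω ^ 2) ^ 2 := by ring
    rw [h1, ← hT, div_pow, eq_div_iff (by positivity)]
    linear_combination (2 * b - ω) ^ 2 * hkT
  have hP4 : (((2 * b - ω) / k) ^ 2) ^ ((1 : ℝ) / 4) = √((2 * b - ω) / k) := by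
    rw [sqrt_eq_rpow, ← rpow_natCast, ← rpow_mul (by positivity)]
    norm_num
  have hV32 : V ^ ((3 : ℝ) / 2) = √(V ^ 3) := by
    rw [sqrt_eq_rpow, ← rpow_natCast, ← rpow_mul hV]
    norm_num
  rw [hP, hP4, hV32]
  symm
  rw [sqrt_eq_iff_mul_self_eq (by positivity) (by positivity), ← pow_two]
  simp only [mul_pow, div_pow]
  rw [sq_sqrt pi_pos.le, sq_sqrt (by positivity), sq_sqrt (by positivity), sq_sqrt (by positivity),
    sq_sqrt (by positivity)]
  field_simp
  ring

/-- The bound of the systolic inequality from the inequality with weights. -/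
theorem sq_mul_le_of_weighted {lσ lv lh V k b x N : ℝ} (hlσ : 0 ≤ lσ) (hlv : 0 ≤ lv)
    (hlh : 0 ≤ lh) (hV : 0 ≤ V) (hk : 0 < k) (hb : 0 < b) (hx : 0 < x) (hN : 0 < N)
    (h : 4 * (k * x * b / N) * lσ + 2 * (b * x / N) * lh + π * (k * x / N) * lv ≤
      √(4 * π * V * (k * x * (3 * b) / N))) :
    (lσ * lv * lh) ^ 2 ≤ π * N ^ 3 * V ^ 3 / (27 * k * b * x ^ 3) := by
  have hpi := pi_pos
  set S := 4 * k * b * lσ + 2 * b * lh + π * k * lv with hS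
  have hS0 : 0 ≤ S := by positivity
  have h1 : (x / N * S) ^ 2 ≤ 4 * π * V * (k * x * (3 * b) / N) := by
    rw [← sq_sqrt (by positivity : 0 ≤ 4 * π * V * (k * x * (3 * b) / N))]
    refine pow_le_pow_left₀ (by positivity) (le_trans (le_of_eq ?_) h) 2
    rw [hS]
    field_simp
  have h2 : S ^ 2 ≤ 12 * π * V * k * b * N / x := by
    rw [le_div_iff₀ hx]
    have h3 : S ^ 2 * x = (x / N * S) ^ 2 * (N ^ 2 / x) := by field_simp
    rw [h3]
    calc _ ≤ 4 * π * V * (k * x * (3 * b) / N) * (N ^ 2 / x) := by gcongr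
      _ = _ := by field_simp; ring
  -- For the extremal lengths $\pi$, $2\pi k$, $4b$ the three terms all equal $4\pi kb$: the
  -- equality case.
  have h4 := add_add_cube_ge (p := 4 * k * b * lσ) (q := 2 * b * lh) (r := π * k * lv)
    (by positivity) (by positivity) (by positivity)
  rw [← hS] at h4
  have h5 : (216 * π * k ^ 2 * b ^ 2 * (lσ * lv * lh)) ^ 2 ≤
      (12 * π * V * k * b * N / x) ^ 3 := by
    calc (216 * π * k ^ 2 * b ^ 2 * (lσ * lv * lh)) ^ 2
        = (27 * (4 * k * b * lσ * (2 * b * lh) * (π * k * lv))) ^ 2 := by ring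
      _ ≤ (S ^ 3) ^ 2 := pow_le_pow_left₀ (by positivity) h4 2
      _ = (S ^ 2) ^ 3 := by ring
      _ ≤ _ := pow_le_pow_left₀ (sq_nonneg S) h2 3
  have h6 : 0 < (216 * π * k ^ 2 * b ^ 2) ^ 2 := by positivity
  refine le_of_mul_le_mul_left ?_ h6
  calc _ = (216 * π * k ^ 2 * b ^ 2 * (lσ * lv * lh)) ^ 2 := by ring
    _ ≤ _ := h5
    _ = _ := by field_simp; ring

theorem vol_nonneg {β : ℝ} (g : RiemannianMetric β) : 0 ≤ vol g :=
  MeasureTheory.integral_nonneg fun _ => sqrt_nonneg _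

end Parameter

end Klein

/-! ### Assembly of the sharp inequality and its equality case. -/

theorem theorem3 (β : ℝ) (hβ : 0 < β) :
    (∃! ω : ℝ, ω ∈ Set.Ioo 0 (π / 2) ∧
      β = 2 * log (tan (π / 4 + ω / 2)) +
        2 / cos ω * (tan ω - ω + √(tan ω ^ 2 - ω * tan ω + ω ^ 2))) ∧
    ∀ ω b : ℝ, ω ∈ Set.Ioo 0 (π / 2) →
      β = 2 * log (tan (π / 4 + ω / 2)) +
        2 / cos ω * (tan ω - ω + √(tan ω ^ 2 - ω * tan ω + ω ^ 2)) →
      b = tan ω + √(tan ω ^ 2 - ω * tan ω + ω ^ 2) →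
      (∀ g : Klein.RiemannianMetric β, Klein.IsConformalTo g (Klein.flatMetric β) →
        Klein.lSigma g * Klein.lVert g * Klein.lHor g ≤
          √π / (3 * √3) *
            ((b ^ 4 - 4 * b * ω + ω ^ 2 + ω ^ 4 - 2 * b ^ 2 * (-2 + ω ^ 2)) ^ ((1 : ℝ) / 4) *
              (2 * b - ω) / ((b - ω) * √((b - ω) * b))) *
            Klein.vol g ^ ((3 : ℝ) / 2)) ∧
      ∃ g : Klein.RiemannianMetric β, Klein.IsConformalTo g (Klein.flatMetric β) ∧
        Klein.IsFlatSpherical ω b g ∧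
        Klein.lSigma g * Klein.lVert g * Klein.lHor g =
          √π / (3 * √3) *
            ((b ^ 4 - 4 * b * ω + ω ^ 2 + ω ^ 4 - 2 * b ^ 2 * (-2 + ω ^ 2)) ^ ((1 : ℝ) / 4) *
              (2 * b - ω) / ((b - ω) * √((b - ω) * b))) *
            Klein.vol g ^ ((3 : ℝ) / 2) := by
  refine ⟨?_, fun ω b hω hωβ hbdef => ?_⟩
  · obtain ⟨ω, ⟨hω, h⟩, huniq⟩ := Klein.existsUnique_modulus_eq hβ
    refine ⟨ω, ⟨hω, ?_⟩, fun ω' h' => huniq ω' ⟨h'.1, ?_⟩⟩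
    · rw [Klein.log_tan_eq_artanh_sin hω]
      exact h
    · rw [Klein.modulus, ← Klein.log_tan_eq_artanh_sin h'.1]
      exact h'.2
  have hk := Klein.cos_pos_of_mem hω
  have hR := Klein.sin_mem_of_mem hω
  have hT0 := Klein.tan_sub_pos hω
  have hroot : 0 ≤ tan ω ^ 2 - ω * tan ω + ω ^ 2 := by
    nlinarith [sq_nonneg (tan ω - ω / 2), sq_nonneg ω]
  have hs0 := sqrt_nonneg (tan ω ^ 2 - ω * tan ω + ω ^ 2)
  have hs2 := sq_sqrt hroot
  have hb : ω < b := by linarith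
  have hb0 : 0 < b := hω.1.trans hb
  have hx : 0 < b - ω := sub_pos.2 hb
  have hN : 0 < 2 * b - ω := by linarith
  -- The definition of $b$ says that it is the larger root of
  -- $b^2-2b\tan\omega+\omega\tan\omega-\omega^2=0$.
  have hT : tan ω * (2 * b - ω) = b ^ 2 - ω ^ 2 := by
    rw [show √(tan ω ^ 2 - ω * tan ω + ω ^ 2) = b - tan ω by linarith] at hs2
    linarith
  have hkT : cos ω ^ 2 * (1 + tan ω ^ 2) = 1 := by
    rw [tan_eq_sin_div_cos]
    field_simp
    linarith [sin_sq_add_cos_sq ω]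
  have hRT : sin ω = cos ω * (b ^ 2 - ω ^ 2) / (2 * b - ω) := by
    rw [eq_div_iff hN.ne', ← hT, tan_eq_sin_div_cos]
    field_simp
  have hβ' : β / 2 = artanh (sin ω) + (b - ω) / cos ω := by
    rw [Klein.log_tan_eq_artanh_sin hω, show tan ω - ω + √(tan ω ^ 2 - ω * tan ω + ω ^ 2) = b - ω by
      linarith] at hωβ
    rw [hωβ]
    ring
  have hk2 : 1 - sin ω ^ 2 = cos ω ^ 2 := by linarith [sin_sq_add_cos_sq ω]
  have hksqrt : √(1 - sin ω ^ 2) = cos ω := by rw [hk2, sqrt_sq hk.le]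
  have harcsin : arcsin (sin ω) = ω := arcsin_sin (by linarith [hω.1, pi_pos]) hω.2.le
  have hvolE : sin ω + (b - ω) * cos ω = cos ω * (b - ω) * (3 * b) / (2 * b - ω) := by
    rw [hRT, eq_div_iff hN.ne', add_mul, div_mul_cancel₀ _ hN.ne']
    ring
  have hmain : ∀ g : Klein.RiemannianMetric β, Klein.IsConformalTo g (Klein.flatMetric β) →
      Klein.lSigma g * Klein.lVert g * Klein.lHor g ≤
        √(π * (2 * b - ω) ^ 3 * Klein.vol g ^ 3 / (27 * cos ω * b * (b - ω) ^ 3)) := by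
    intro g hg
    obtain ⟨q, hq⟩ := hg.exists_factor
    refine le_sqrt_of_sq_le (Klein.sq_mul_le_of_weighted (Klein.leastLength_nonneg _ _)
      (Klein.leastLength_nonneg _ _) (Klein.leastLength_nonneg _ _) (Klein.vol_nonneg g) hk hb0 hx
      hN ?_)
    -- Equality of the three weighted terms for $E_b$ means $\tan\omega-a\omega=(1-a)(b-\omega)=ab$.
    -- The second equality gives this $a$, and the first is then `hT`. The value of $d$ is the
    -- conformal height of the flat zone.
    have h := hq.weighted_inequality hβ (R := sin ω) (a := (b - ω) / (2 * b - ω))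
      (d := (b - ω) / cos ω) hR.1 hR.2 (by positivity) (by rw [div_le_one hN]; linarith)
      (by positivity) hβ'
    rw [hksqrt, harcsin, hk2] at h
    have e1 : sin ω - (b - ω) / (2 * b - ω) * cos ω * ω = cos ω * (b - ω) * b / (2 * b - ω) := by
      rw [hRT]
      field_simp
      ring
    have e2 : 2 * (1 - (b - ω) / (2 * b - ω)) * cos ω * ((b - ω) / cos ω) =
        2 * (b * (b - ω) / (2 * b - ω)) := by
      field_simp
      ring
    have e3 : (b - ω) / (2 * b - ω) * cos ω = cos ω * (b - ω) / (2 * b - ω) := by ring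
    have e4 : sin ω + cos ω ^ 2 * ((b - ω) / cos ω) =
        cos ω * (b - ω) * (3 * b) / (2 * b - ω) := by
      rw [← hvolE]
      field_simp
    rw [e1, e2, e3, e4] at h
    exact h
  refine ⟨fun g hg => ?_, ?_⟩
  · rw [Klein.bound_eq_sqrt hk hb0 hb hN hT hkT (Klein.vol_nonneg g)]
    exact hmain g hg
  · have hβo : β / 2 = Klein.ordinate ω b b := by rw [hβ', Klein.ordinate_self hω hb.le]
    have hconf := (Klein.isConformalFactor_flatSpherical hω hβo).isConformalTo
    refine ⟨Klein.flatSpherical hω hβo, hconf, Klein.isFlatSpherical_flatSpherical hω hβo, ?_⟩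
    rw [Klein.bound_eq_sqrt hk hb0 hb hN hT hkT (Klein.vol_nonneg _)]
    refine le_antisymm (hmain _ hconf) ?_
    rw [Klein.vol_flatSpherical hω hb.le hβo hβ, hvolE]
    have h1 := Klein.le_lSigma_flatSpherical hω hβo hβ
    have h2 := Klein.le_lVert_flatSpherical hω hβo hb0 hβ
    have h3 := Klein.le_lHor_flatSpherical hω hβo hβ
    have hpi := pi_pos
    -- With the area of $E_b$ inserted, the bound is exactly the product of the three lower bounds.
    calc _ = √((π * (4 * b) * (2 * π * cos ω)) ^ 2) := by
          congr 1
          field_simp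
          ring
      _ = π * (4 * b) * (2 * π * cos ω) := sqrt_sq (by positivity)
      _ ≤ _ := mul_le_mul (mul_le_mul h1 h2 (by positivity) (by linarith)) h3 (by positivity)
          (mul_nonneg (by linarith) (by linarith))
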